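/- Let $\alpha,\beta\in\mathbb R$ with $\alpha>\tfrac12$ and $\alpha>\beta>-\tfrac12$, and put $\rho=\alpha+\beta+1$. For $\lambda\in\mathbb C$ with $\Im\lambda\ge 0$ let $\Gamma_0(\lambda)=1$ and, for $k\ge 0$, $$(k+1)(k+1-i\lambda)\Gamma_{k+1}(\lambda)=(\alpha-\beta)\sum_{j=0}^{k}(\rho+2j-i\lambda)\Gamma_j(\lambda)+(2\beta+1)\sum_{j=1}^{\lfloor (k+1)/2\rfloor}(\rho+2(k+1-2j)-i\lambda)\Gamma_{k+1-2j}(\lambda).$$ Let $\phi_\lambda(t)=\sum_{k\ge 0}\Gamma_k(\lambda)e^{-2kt}$ be the Harish-Chandra series. It converges for $t>0$, and $u(t)=e^{(i\lambda-\rho)t}\phi_\lambda(t)$ is a solution of $$u''+\bigl((2\alpha+1)\coth t+(2\beta+1)\tanh t\bigr)u'+(\lambda^2+\rho^2)u=0,\quad t>0,$$ with $u(t)=e^{(i\lambda-\rho)t}(1+o(1))$ as $t\to\infty$. For $b\in\mathbb N_0$ and $t>1$ put $G_b(t)=\sum_{j\ge 0}j^b e^{2j(1-t)}$, with $0^0=1$.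 There exist constants $A_a$ ($a\in\mathbb N_0$), depending only on $a,\alpha,\beta$, and functions $\gamma_m^k$ ($m,k\ge 0$) such that, with $A=A_0$, the following holds. (i) Each $\gamma_m^k$ is a finite (possibly empty) sum of functions $1/f$, where the $f$ are complex polynomials in $\lambda$ of degree exactly $m$ without zeros in $\{\Im\lambda\ge 0\}$. For all $M,k\ge 0$ and all $\lambda$ with $\Im\lambda\ge 0$, $$\Gamma_k(\lambda)=\sum_{m=0}^{M}\gamma_m^k(\lambda)+E_{M+1}^k(\lambda),$$ where, if moreover $\Re\lambda\neq 0$, for all $m,M,k,a\ge 0$, $$|\gamma_m^k(\lambda)|\le A\frac{|\rho|^m e^{2k}}{|\Re\lambda|^m},\qquad |D_{\Re\lambda}^a\gamma_m^k(\lambda)|\le 2^aA_a\frac{|\rho|^m e^{2k}}{|\Re\lambda|^{m+a}},\qquad |E_{M+1}^k(\lambda)|\le A\frac{|\rho|^{M+1}e^{2k}}{|\Re\lambda|^{M+1}}.$$ (ii) For $\Im\lambda\ge 0$ and $t>1$ the series $\Lambda_m(\lambda,t)=\sum_{j\ge 0}\gamma_m^{m+j}(\lambda)e^{-2jt}$ converge.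 They are smooth in $t$, and each $D_t^b\Lambda_m(\cdot,t)$ extends to be holomorphic in a neighbourhood of $\{\Im\lambda\ge 0\}$. There are functions $\mathcal E_{M+1}(\lambda,t)$, smooth in $t>1$, such that for all $M\ge 0$, all $\lambda$ with $\Im\lambda\ge 0$ and all $t>1$ (in particular for all $t\ge R_0$, whenever $R_0>1$), $$\phi_\lambda(t)=\sum_{m=0}^{\infty}\Lambda_m(\lambda,t)e^{-2mt}=\sum_{m=0}^{M}\Lambda_m(\lambda,t)e^{-2mt}+e^{-2(M+1)t}\mathcal E_{M+1}(\lambda,t),$$ and, if moreover $\Re\lambda\ne 0$, for all $a,b,m,M\ge 0$, $$|D_\lambda^aD_t^b\Lambda_m(\lambda,t)|\le 2^{a+b}A_a\frac{|\rho|^m e^{2m}}{|\Re\lambda|^{m+a}}G_b(t),\qquad |D_t^b\mathcal E_{M+1}(\lambda,t)|\le 2^bA\frac{e^{2(M+1)}|\rho|^{M+1}}{|\Re\lambda|^{M+1}}G_b(t).$$ -/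

import Mathlib

open scoped BigOperators Topology ContDiff

/-- `ρ = α + β + 1`. -/
noncomputable def jacobiRho (α β : ℝ) : ℝ := α + β + 1

/-- The Harish-Chandra coefficients `Γ_k(λ)`: `Γ_0 = 1` and
`(k+1)(k+1-iλ) Γ_{k+1} = (α-β) ∑_{j=0}^{k} (ρ+2j-iλ) Γ_j
  + (2β+1) ∑_{j=1}^{⌊(k+1)/2⌋} (ρ+2(k+1-2j)-iλ) Γ_{k+1-2j}`.
In the second sum below the index is `j + 1` with `0 ≤ j < ⌊(k+1)/2⌋`. -/
noncomputable def hcCoeff (α β : ℝ) (lam : ℂ) : ℕ → ℂ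
  | 0 => 1
  | k + 1 =>
      (((α - β : ℝ) : ℂ) * ∑ j : Fin (k + 1),
          ((jacobiRho α β : ℂ) + 2 * ((j : ℕ) : ℂ) - Complex.I * lam) * hcCoeff α β lam (j : ℕ)
        + ((2 * β + 1 : ℝ) : ℂ) * ∑ j : Fin ((k + 1) / 2),
          ((jacobiRho α β : ℂ) + 2 * ((k + 1 - 2 * ((j : ℕ) + 1) : ℕ) : ℂ) - Complex.I * lam) *
            hcCoeff α β lam (k + 1 - 2 * ((j : ℕ) + 1)))
      / (((k : ℂ) + 1) * ((k : ℂ) + 1 - Complex.I * lam))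
  decreasing_by all_goals omega

/-- The Harish-Chandra series `φ_λ(t) = ∑_k Γ_k(λ) e^{-2kt}`. -/
noncomputable def hcSeries (α β : ℝ) (lam : ℂ) (t : ℝ) : ℂ :=
  ∑' k : ℕ, hcCoeff α β lam k * (Real.exp (-(2 * (k : ℝ) * t)) : ℂ)

/-- The Jacobi Laplacian
`u'' + ((2α+1) coth t + (2β+1) tanh t) u'`. -/
noncomputable def jacobiLaplacian (α β : ℝ) (u : ℝ → ℂ) (t : ℝ) : ℂ :=
  iteratedDeriv 2 u t
    + (((2 * α + 1) * (Real.cosh t / Real.sinh t) + (2 * β + 1) * Real.tanh t : ℝ) : ℂ) * deriv u t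

/-- `u` is a `C²` solution on `(0, ∞)` of `𝓛u + (λ² + ρ²)u = 0` with
`u(t) = e^{(iλ-ρ)t}(1 + o(1))` as `t → ∞`. -/
def IsJacobiSolutionAtInfinity (α β : ℝ) (lam : ℂ) (u : ℝ → ℂ) : Prop :=
  ContDiffOn ℝ 2 u (Set.Ioi 0) ∧
  (∀ t : ℝ, 0 < t →
    jacobiLaplacian α β u t + (lam ^ 2 + (jacobiRho α β : ℂ) ^ 2) * u t = 0) ∧
  Filter.Tendsto
    (fun t : ℝ => u t / Complex.exp ((Complex.I * lam - (jacobiRho α β : ℂ)) * (t : ℂ)))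
    Filter.atTop (𝓝 1)

/-- The finite sum of the reciprocals `1 / f(λ)`, `f` running through the family `P`. -/
noncomputable def recipSum (P : Multiset (Polynomial ℂ)) (lam : ℂ) : ℂ :=
  (P.map fun f => 1 / f.eval lam).sum

/-- `Λ_m(λ,t) = ∑_{j ≥ 0} γ_m^{m+j}(λ) e^{-2jt}`, where `γ m k` stands for `γ_m^k`. -/
noncomputable def hcLambda (γ : ℕ → ℕ → ℂ → ℂ) (m : ℕ) (lam : ℂ) (t : ℝ) : ℂ :=
  ∑' j : ℕ, γ m (m + j) lam * (Real.exp (-(2 * (j : ℝ) * t)) : ℂ)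

/-- `G_b(t) = ∑_{j ≥ 0} j^b e^{2j(1-t)}` (with `0^0 = 1`). -/
noncomputable def hcG (b : ℕ) (t : ℝ) : ℝ :=
  ∑' j : ℕ, (j : ℝ) ^ b * Real.exp (2 * (j : ℝ) * (1 - t))

/-!
Write `ρ + 2j - iλ = (k + 1 - iλ) + (ρ + 2j - (k + 1))`. With `c_n = ρ` for even `n` and
`c_n = α - β` for odd `n`, so that `0 < c_n ≤ ρ`, the recursion for the Harish-Chandra coefficients
becomes
`(k+1) Γ_{k+1} = ∑_{j≤k} c_{k+1-j} (1 + (ρ + 2j - (k+1)) / (k + 1 - iλ)) Γ_j`  (`hcCoeff_succ'`).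
Unfolding it and sorting the terms by the number `m` of factors `1/(k + 1 - iλ)` gives the terms
`γ_m^k`: sums of reciprocals of products of `m` such factors, which have no zeros in `Im λ > -1`.
Both `γ_m^k` and the remainder `E_m^k = Γ_k - ∑_{l<m} γ_l^k` solve the same graded recursion
(`IsGradedSolution`), and both vanish for `m > k`.

All bounds come from comparing this recursion with the extremal sequence `growthBound δ K`. Off the
imaginary axis, `|k + 1 - iλ| ≥ |Re λ|` gives
`|γ_m^k|, |E_m^k| ≤ (ρ / |Re λ|)^m growthBound 1 K k`, whose growth in `k` is of rate `2 < e²`. In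
the half-plane `Im λ > -1/2`, `|k + 1 - iλ| ≥ (k + 1)/2` gives the bound `growthBound 0 K k`, which
grows subexponentially; hence all series converge for `t > 0`, locally uniformly in `λ`, and the
double series over `m` and `k` converges absolutely.

Derivatives in `t` are taken term by term in Dirichlet series in `e^{-2t}`. Derivatives in `λ` are
estimated by Cauchy's inequality on the disc of radius `|Re λ| / (m + 2)`, on which the bound off
the imaginary axis worsens by a factor of at most `e`. The loss `(m + 2)^a ≤ (k + 2)^a` is absorbed
by the room between the growth rate `2` and `e²` (`exists_growthBound_one_le_exp`).

Finally, `coth t` and `tanh t` are power series in `e^{-2t}`, and the recursion for `Γ_k` says that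
the coefficients of the differential equation vanish (`hcCoeff_drift`).
-/

/-! ### Dirichlet series in `e^{-2t}` -/

/-- The Dirichlet series `∑_j c_j e^{-2jt}`. -/
noncomputable def dirichletSum (c : ℕ → ℂ) (t : ℝ) : ℂ :=
  ∑' j : ℕ, c j * (Real.exp (-(2 * (j : ℝ) * t)) : ℂ)

/-- `∑_j c_j e^{-2js}` converges absolutely for every `s > σ`. -/
def AbsConvAbove (σ : ℝ) (c : ℕ → ℂ) : Prop :=
  ∀ s : ℝ, σ < s → Summable fun j : ℕ => ‖c j‖ * Real.exp (-(2 * (j : ℝ) * s))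

lemma norm_dirichlet_term (c : ℂ) (x : ℝ) :
    ‖c * (Real.exp x : ℂ)‖ = ‖c‖ * Real.exp x := by
  rw [norm_mul, Complex.norm_real, Real.norm_of_nonneg (Real.exp_pos _).le]

lemma AbsConvAbove.summable_norm {σ : ℝ} {c : ℕ → ℂ} (h : AbsConvAbove σ c) {t : ℝ}
    (ht : σ < t) : Summable fun j : ℕ => ‖c j * (Real.exp (-(2 * (j : ℝ) * t)) : ℂ)‖ := by
  simpa only [norm_dirichlet_term] using h t ht

lemma AbsConvAbove.summable {σ : ℝ} {c : ℕ → ℂ} (h : AbsConvAbove σ c) {t : ℝ}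
    (ht : σ < t) : Summable fun j : ℕ => c j * (Real.exp (-(2 * (j : ℝ) * t)) : ℂ) :=
  (h.summable_norm ht).of_norm

lemma AbsConvAbove.hasSum {σ : ℝ} {c : ℕ → ℂ} (h : AbsConvAbove σ c) {t : ℝ} (ht : σ < t) :
    HasSum (fun j : ℕ => c j * (Real.exp (-(2 * (j : ℝ) * t)) : ℂ)) (dirichletSum c t) :=
  (h.summable ht).hasSum

lemma AbsConvAbove.of_le {σ : ℝ} {c : ℕ → ℂ} {B : ℕ → ℝ} (hc : ∀ j, ‖c j‖ ≤ B j)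
    (hB : ∀ s : ℝ, σ < s → Summable fun j : ℕ => B j * Real.exp (-(2 * (j : ℝ) * s))) :
    AbsConvAbove σ c := fun s hs =>
  Summable.of_nonneg_of_le (fun j => by positivity)
    (fun j => mul_le_mul_of_nonneg_right (hc j) (Real.exp_pos _).le) (hB s hs)

/-- A power of `j` is absorbed by an arbitrarily small part of the exponential decay. -/
lemma pow_mul_exp_neg_le (b : ℕ) {δ : ℝ} (hδ : 0 < δ) (j : ℕ) :
    (j : ℝ) ^ b * Real.exp (-(j * δ)) ≤ b.factorial / δ ^ b := by
  have h := Real.pow_div_factorial_le_exp (j * δ) (by positivity) b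
  rw [div_le_iff₀ (by positivity), mul_pow] at h
  rw [Real.exp_neg, le_div_iff₀ (by positivity)]
  calc (j : ℝ) ^ b * (Real.exp (j * δ))⁻¹ * δ ^ b
      = (j : ℝ) ^ b * δ ^ b * (Real.exp (j * δ))⁻¹ := by ring
    _ ≤ Real.exp (j * δ) * b.factorial * (Real.exp (j * δ))⁻¹ := by gcongr
    _ = b.factorial := by
      have := (Real.exp_pos (j * δ)).ne'
      field_simp

lemma AbsConvAbove.summable_pow {σ : ℝ} {c : ℕ → ℂ} (h : AbsConvAbove σ c) (b : ℕ) {s : ℝ}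
    (hs : σ < s) :
    Summable fun j : ℕ => (j : ℝ) ^ b * (‖c j‖ * Real.exp (-(2 * (j : ℝ) * s))) := by
  obtain ⟨r, hr, hrs⟩ := exists_between hs
  have hδ : 0 < 2 * (s - r) := by linarith
  refine Summable.of_nonneg_of_le (fun j => by positivity) (fun j => ?_)
    ((h r hr).mul_left (b.factorial / (2 * (s - r)) ^ b))
  have e : Real.exp (-(2 * (j : ℝ) * s))
      = Real.exp (-(j * (2 * (s - r)))) * Real.exp (-(2 * (j : ℝ) * r)) := by
    rw [← Real.exp_add]; congr 1; ring
  calc (j : ℝ) ^ b * (‖c j‖ * Real.exp (-(2 * (j : ℝ) * s)))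
      = ((j : ℝ) ^ b * Real.exp (-(j * (2 * (s - r))))) *
          (‖c j‖ * Real.exp (-(2 * (j : ℝ) * r))) := by rw [e]; ring
    _ ≤ _ := mul_le_mul_of_nonneg_right (pow_mul_exp_neg_le b hδ j) (by positivity)

lemma norm_mul_neg_two_mul_pow (c : ℂ) (j b : ℕ) :
    ‖c * (-(2 * (j : ℂ))) ^ b‖ = 2 ^ b * ((j : ℝ) ^ b * ‖c‖) := by
  rw [norm_mul, norm_pow, norm_neg, norm_mul, Complex.norm_natCast, Complex.norm_ofNat, mul_pow]
  ring

lemma AbsConvAbove.mul_pow {σ : ℝ} {c : ℕ → ℂ} (h : AbsConvAbove σ c) (b : ℕ) :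
    AbsConvAbove σ fun j => c j * (-(2 * (j : ℂ))) ^ b := fun s hs => by
  refine ((h.summable_pow b hs).mul_left (2 ^ b)).congr fun j => ?_
  rw [norm_mul_neg_two_mul_pow]; ring

lemma AbsConvAbove.hasDerivAt {σ : ℝ} {c : ℕ → ℂ} (h : AbsConvAbove σ c) {t : ℝ} (ht : σ < t) :
    HasDerivAt (dirichletSum c) (dirichletSum (fun j => c j * (-(2 * (j : ℂ)))) t) t := by
  obtain ⟨r, hr, hrt⟩ := exists_between ht
  have h1 := (h.mul_pow 1) r hr
  simp only [pow_one] at h1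
  refine hasDerivAt_tsum_of_isPreconnected (t := Set.Ioi r) h1 isOpen_Ioi isPreconnected_Ioi
    (g := fun (j : ℕ) (s : ℝ) => c j * (Real.exp (-(2 * (j : ℝ) * s)) : ℂ))
    (g' := fun (j : ℕ) (s : ℝ) => c j * (-(2 * (j : ℂ))) * (Real.exp (-(2 * (j : ℝ) * s)) : ℂ))
    (fun j s _ => ?_) (fun j s hs => ?_) (y₀ := t) hrt (h.summable ht) hrt
  · have h2 : HasDerivAt (fun s : ℝ => Real.exp (-(2 * (j : ℝ) * s)))
        (Real.exp (-(2 * (j : ℝ) * s)) * (-(2 * (j : ℝ) * 1))) s :=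
      (((hasDerivAt_id s).const_mul (2 * (j : ℝ))).neg).exp
    refine (h2.ofReal_comp.const_mul (c j)).congr_deriv ?_
    push_cast; ring
  · rw [norm_dirichlet_term]
    have : r ≤ s := (Set.mem_Ioi.1 hs).le
    gcongr

lemma AbsConvAbove.iteratedDeriv_eq {σ : ℝ} {c : ℕ → ℂ} (h : AbsConvAbove σ c) (b : ℕ) :
    ∀ {t : ℝ}, σ < t → iteratedDeriv b (dirichletSum c) t =
      dirichletSum (fun j => c j * (-(2 * (j : ℂ))) ^ b) t := by
  induction b with
  | zero => intro t _; simp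
  | succ b ih =>
    intro t ht
    have he : iteratedDeriv b (dirichletSum c) =ᶠ[𝓝 t]
        dirichletSum (fun j => c j * (-(2 * (j : ℂ))) ^ b) := by
      filter_upwards [isOpen_Ioi.mem_nhds ht] with s hs using ih hs
    rw [iteratedDeriv_succ, he.deriv_eq, ((h.mul_pow b).hasDerivAt ht).deriv]
    simp only [pow_succ, mul_assoc]

lemma AbsConvAbove.contDiffOn {σ : ℝ} {c : ℕ → ℂ} (h : AbsConvAbove σ c) :
    ContDiffOn ℝ ∞ (dirichletSum c) (Set.Ioi σ) := by
  have key : ∀ (n : ℕ) (c : ℕ → ℂ), AbsConvAbove σ c →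
      ContDiffOn ℝ n (dirichletSum c) (Set.Ioi σ) := by
    intro n
    induction n with
    | zero =>
      intro c h
      exact contDiffOn_zero.2 fun t ht => (h.hasDerivAt ht).continuousAt.continuousWithinAt
    | succ n ih =>
      intro c h
      have h' : AbsConvAbove σ fun j => c j * (-(2 * (j : ℂ))) := by simpa using h.mul_pow 1
      push_cast
      refine (contDiffOn_succ_iff_deriv_of_isOpen isOpen_Ioi).2
        ⟨fun t ht => (h.hasDerivAt ht).differentiableAt.differentiableWithinAt, by simp, ?_⟩
      exact (ih _ h').congr fun t ht => (h.hasDerivAt ht).deriv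
  exact contDiffOn_infty.2 fun n => key n c h

lemma summable_hcG (b : ℕ) {t : ℝ} (ht : 1 < t) :
    Summable fun j : ℕ => (j : ℝ) ^ b * Real.exp (2 * (j : ℝ) * (1 - t)) := by
  have h0 : AbsConvAbove 0 fun _ => (1 : ℂ) := fun s hs => by
    have := Real.summable_exp_nat_mul_iff.2 (show -(2 * s) < 0 by linarith)
    refine this.congr fun j => ?_
    simp only [norm_one, one_mul]; congr 1; ring
  refine (h0.summable_pow b (s := t - 1) (by linarith)).congr fun j => ?_
  simp only [norm_one, one_mul]; congr 2; ring

lemma absConvAbove_one_of_le {c : ℕ → ℂ} {C : ℝ} (hc : ∀ j : ℕ, ‖c j‖ ≤ C * Real.exp (2 * j)) :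
    AbsConvAbove 1 c := by
  refine AbsConvAbove.of_le hc fun s hs => ?_
  refine ((summable_hcG 0 hs).mul_left C).congr fun j => ?_
  rw [pow_zero, one_mul, mul_assoc C, ← Real.exp_add]
  congr 2; ring

/-- Coefficients of size `C e^{2j}` give a `b`-th derivative of size `2^b C G_b(t)`. -/
lemma norm_dirichletSum_mul_pow_le {c : ℕ → ℂ} {C : ℝ}
    (hc : ∀ j : ℕ, ‖c j‖ ≤ C * Real.exp (2 * j)) (b : ℕ) {t : ℝ} (ht : 1 < t) :
    ‖dirichletSum (fun j => c j * (-(2 * (j : ℂ))) ^ b) t‖ ≤ 2 ^ b * C * hcG b t := by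
  refine tsum_of_norm_bounded ((summable_hcG b ht).hasSum.mul_left (2 ^ b * C)) fun j => ?_
  rw [norm_dirichlet_term, norm_mul_neg_two_mul_pow]
  have e : Real.exp (2 * (j : ℝ) * (1 - t))
      = Real.exp (2 * j) * Real.exp (-(2 * (j : ℝ) * t)) := by
    rw [← Real.exp_add]; congr 1; ring
  rw [e]
  calc 2 ^ b * ((j : ℝ) ^ b * ‖c j‖) * Real.exp (-(2 * (j : ℝ) * t))
      ≤ 2 ^ b * ((j : ℝ) ^ b * (C * Real.exp (2 * j))) * Real.exp (-(2 * (j : ℝ) * t)) := by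
        gcongr; exact hc j
    _ = _ := by ring

lemma norm_iteratedDeriv_dirichletSum_le {c : ℕ → ℂ} {C : ℝ}
    (hc : ∀ j : ℕ, ‖c j‖ ≤ C * Real.exp (2 * j)) (b : ℕ) {t : ℝ} (ht : 1 < t) :
    ‖iteratedDeriv b (dirichletSum c) t‖ ≤ 2 ^ b * C * hcG b t := by
  rw [(absConvAbove_one_of_le hc).iteratedDeriv_eq b ht]
  exact norm_dirichletSum_mul_pow_le hc b ht

/-! ### Growth of the extremal sequence -/

/-- `∏_{i<k} (1 + δ + K/(i+1))`, the partial sums of `growthBound δ K`. -/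
noncomputable def growthSum (δ K : ℝ) (k : ℕ) : ℝ :=
  ∏ i ∈ Finset.range k, (1 + δ + K / ((i : ℝ) + 1))

/-- The sequence with `B_0 = 1` and `(k+1) B_{k+1} = (δ(k+1) + K) ∑_{j≤k} B_j`. It is the extremal
solution of the recursive inequalities satisfied by the Harish-Chandra coefficients. -/
noncomputable def growthBound (δ K : ℝ) : ℕ → ℝ
  | 0 => 1
  | k + 1 => (δ + K / ((k : ℝ) + 1)) * growthSum δ K k

section growth

variable {δ K : ℝ}

lemma growthSum_succ (k : ℕ) :
    growthSum δ K (k + 1) = growthSum δ K k * (1 + δ + K / ((k : ℝ) + 1)) :=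
  Finset.prod_range_succ _ _

lemma sum_growthBound (k : ℕ) :
    ∑ j ∈ Finset.range (k + 1), growthBound δ K j = growthSum δ K k := by
  induction k with
  | zero => simp [growthBound, growthSum]
  | succ k ih =>
    rw [Finset.sum_range_succ, ih, growthSum_succ, growthBound]; ring

lemma growthBound_succ (k : ℕ) :
    growthBound δ K (k + 1) =
      (∑ j ∈ Finset.range (k + 1), (δ * ((k : ℝ) + 1) + K) * growthBound δ K j) / ((k : ℝ) + 1) := by
  rw [← Finset.mul_sum, sum_growthBound, growthBound]
  have : (k : ℝ) + 1 ≠ 0 := by positivity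
  field_simp

lemma one_le_growthSum (hδ : 0 ≤ δ) (hK : 0 ≤ K) (k : ℕ) : 1 ≤ growthSum δ K k := by
  unfold growthSum
  refine Finset.one_le_prod fun i _ => ?_
  have : 0 ≤ K / ((i : ℝ) + 1) := by positivity
  linarith

lemma growthSum_monotone (hδ : 0 ≤ δ) (hK : 0 ≤ K) : Monotone (growthSum δ K) := by
  refine monotone_nat_of_le_succ fun k => ?_
  rw [growthSum_succ]
  have h1 := one_le_growthSum hδ hK k
  have : 0 ≤ K / ((k : ℝ) + 1) := by positivity
  exact le_mul_of_one_le_right (by linarith) (by linarith)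

lemma growthBound_nonneg (hδ : 0 ≤ δ) (hK : 0 ≤ K) (k : ℕ) : 0 ≤ growthBound δ K k := by
  cases k with
  | zero => simp [growthBound]
  | succ k =>
    have := one_le_growthSum hδ hK k
    have h0 : 0 ≤ growthSum δ K k := by linarith
    rw [growthBound]; positivity

lemma growthBound_le_growthSum (hδ : 0 ≤ δ) (hK : 0 ≤ K) (k : ℕ) :
    growthBound δ K k ≤ growthSum δ K k := by
  rw [← sum_growthBound]
  exact Finset.single_le_sum (f := growthBound δ K) (fun j _ => growthBound_nonneg hδ hK j)
    (Finset.self_mem_range_succ k)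

lemma growthBound_mono_left {ε : ℝ} (hδ : 0 ≤ δ) (hK : 0 ≤ K) (hε : δ ≤ ε) (k : ℕ) :
    growthBound δ K k ≤ growthBound ε K k := by
  cases k with
  | zero => simp [growthBound]
  | succ k =>
    have hε0 : 0 ≤ ε := hδ.trans hε
    rw [growthBound, growthBound]
    refine mul_le_mul (by linarith) ?_ (by linarith [one_le_growthSum hδ hK k]) (by positivity)
    unfold growthSum
    exact Finset.prod_le_prod (fun i _ => by positivity) fun i _ => by linarith

/-- The factors of `growthSum` tend to `1 + δ`, so the growth rate is `1 + δ`. -/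
lemma exists_growthBound_le_geometric (hδ : 0 ≤ δ) (hK : 0 ≤ K) {q : ℝ} (hq : 1 + δ < q) :
    ∃ C : ℝ, 0 ≤ C ∧ ∀ k, growthBound δ K k ≤ C * q ^ k := by
  obtain ⟨N, hN⟩ := exists_nat_gt (K / (q - 1 - δ))
  have hq0 : 0 < q - 1 - δ := by linarith
  have hN0 : 0 ≤ growthSum δ K N := by linarith [one_le_growthSum hδ hK N]
  refine ⟨growthSum δ K N, hN0, fun k => (growthBound_le_growthSum hδ hK k).trans ?_⟩
  have h1q : 1 ≤ q := by linarith
  rcases le_total k N with hk | hk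
  · exact (growthSum_monotone hδ hK hk).trans
      (le_mul_of_one_le_right hN0 (one_le_pow₀ h1q))
  · induction k, hk using Nat.le_induction with
    | base => exact le_mul_of_one_le_right hN0 (one_le_pow₀ h1q)
    | succ k hk ih =>
      have hk' : (N : ℝ) ≤ k := by exact_mod_cast hk
      have hlt : K / ((k : ℝ) + 1) ≤ q - 1 - δ := by
        rw [div_lt_iff₀ hq0] at hN
        rw [div_le_iff₀ (by positivity)]
        nlinarith
      rw [growthSum_succ, pow_succ, ← mul_assoc]
      exact mul_le_mul ih (by linarith) (by positivity) (by positivity)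

lemma summable_growthBound_mul_exp (hK : 0 ≤ K) {s : ℝ} (hs : 0 < s) :
    Summable fun k : ℕ => growthBound 0 K k * Real.exp (-(2 * (k : ℝ) * s)) := by
  obtain ⟨C, -, hC⟩ := exists_growthBound_le_geometric le_rfl hK (q := Real.exp s)
    (by simpa using hs)
  refine Summable.of_nonneg_of_le
    (fun k => mul_nonneg (growthBound_nonneg le_rfl hK k) (Real.exp_pos _).le) (fun k => ?_)
    ((Real.summable_exp_nat_mul_iff.2 (neg_lt_zero.2 hs)).mul_left C)
  calc growthBound 0 K k * Real.exp (-(2 * (k : ℝ) * s))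
      ≤ C * Real.exp s ^ k * Real.exp (-(2 * (k : ℝ) * s)) := by gcongr; exact hC k
    _ = C * Real.exp (k * -s) := by
      rw [← Real.exp_nat_mul, mul_assoc, ← Real.exp_add]; congr 2; ring

lemma summable_growthBound_add_mul_exp (hK : 0 ≤ K) (m : ℕ) {s : ℝ} (hs : 0 < s) :
    Summable fun k : ℕ => growthBound 0 K (m + k) * Real.exp (-(2 * (k : ℝ) * s)) := by
  have h := ((summable_nat_add_iff m).2 (summable_growthBound_mul_exp hK hs)).mul_left
    (Real.exp (2 * m * s))
  refine h.congr fun k => ?_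
  rw [add_comm k m, mul_left_comm, ← Real.exp_add]
  congr 2; push_cast; ring

/-- As `3 < e²`, the growth rate `2` leaves room for a polynomial factor, which is what an
`a`-th derivative costs by Cauchy's estimate. -/
lemma exists_growthBound_one_le_exp (hK : 0 ≤ K) (a : ℕ) :
    ∃ A : ℝ, 0 ≤ A ∧ ∀ k : ℕ,
      a.factorial * ((k : ℝ) + 2) ^ a * Real.exp 1 * growthBound 1 K k ≤ A * Real.exp (2 * k) := by
  -- `(k + 2)^a` costs a factor `e^{k/2}`, and `3 e^{1/2} ≤ e^{3/2} e^{1/2} = e²`.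
  obtain ⟨C, hC0, hC⟩ := exists_growthBound_le_geometric zero_le_one hK (q := 3) (by norm_num)
  refine ⟨a.factorial * (2 ^ a * (a.factorial * Real.exp 1)) * Real.exp 1 * C, by positivity,
    fun k => ?_⟩
  have h3 : (3 : ℝ) ≤ Real.exp (3 / 2) := by
    refine le_of_sq_le_sq ?_ (Real.exp_pos _).le
    rw [← Real.exp_nat_mul, show ((2 : ℕ) : ℝ) * (3 / 2) = ((3 : ℕ) : ℝ) * 1 by norm_num,
      Real.exp_nat_mul]
    have := Real.exp_one_gt_d9
    calc (3 : ℝ) ^ 2 ≤ 2.7 ^ 3 := by norm_num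
      _ ≤ Real.exp 1 ^ 3 := by gcongr; linarith
  have hp : ((k : ℝ) + 2) ^ a ≤ 2 ^ a * (a.factorial * Real.exp 1) * Real.exp (1 / 2) ^ k := by
    have h := Real.pow_div_factorial_le_exp (((k : ℝ) + 2) / 2) (by positivity) a
    rw [div_le_iff₀ (by positivity), div_pow, div_le_iff₀ (by positivity)] at h
    refine h.trans_eq ?_
    rw [← Real.exp_nat_mul, show ((k : ℝ) + 2) / 2 = k * (1 / 2) + 1 by ring, Real.exp_add]
    ring
  have hB := hC k
  have he : Real.exp (1 / 2) ^ k * (3 : ℝ) ^ k ≤ Real.exp (2 * k) := by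
    rw [← mul_pow, mul_comm (2 : ℝ), Real.exp_nat_mul]
    gcongr
    calc Real.exp (1 / 2) * 3 ≤ Real.exp (1 / 2) * Real.exp (3 / 2) := by gcongr
      _ = Real.exp 2 := by rw [← Real.exp_add]; norm_num
  have hB0 := growthBound_nonneg zero_le_one hK k
  calc a.factorial * ((k : ℝ) + 2) ^ a * Real.exp 1 * growthBound 1 K k
      ≤ a.factorial * (2 ^ a * (a.factorial * Real.exp 1) * Real.exp (1 / 2) ^ k) * Real.exp 1 *
          (C * 3 ^ k) := by gcongr
    _ = a.factorial * (2 ^ a * (a.factorial * Real.exp 1)) * Real.exp 1 * C *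
          (Real.exp (1 / 2) ^ k * 3 ^ k) := by ring
    _ ≤ _ := by gcongr

lemma growthBound_le_of_zeroth (hK : 0 ≤ K) {A : ℝ} (hA : ∀ k : ℕ,
    (Nat.factorial 0 : ℕ) * ((k : ℝ) + 2) ^ 0 * Real.exp 1 * growthBound 1 K k ≤
      A * Real.exp (2 * k)) (k : ℕ) : growthBound 1 K k ≤ A * Real.exp (2 * k) := by
  refine le_trans ?_ (hA k)
  rw [Nat.factorial_zero, Nat.cast_one, pow_zero, one_mul, one_mul]
  exact le_mul_of_one_le_left (growthBound_nonneg zero_le_one hK k) (Real.one_le_exp zero_le_one)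

end growth

/-! ### Recursions for the coefficients, the terms and the remainders -/

/-- The weight `c_n` of `Γ_{k+1-n}` in the recursion for `Γ_{k+1}`. -/
noncomputable def hcWeight (α β : ℝ) (n : ℕ) : ℝ :=
  if Even n then jacobiRho α β else α - β

/-- The value of `ρ + 2j - iλ` at the zero `iλ = k + 1` of `k + 1 - iλ`, that is, the remainder in
`ρ + 2j - iλ = (k + 1 - iλ) + (ρ + 2j - (k + 1))`. -/
noncomputable def hcShift (α β : ℝ) (k j : ℕ) : ℝ :=
  jacobiRho α β + 2 * j - (k + 1)

/-- The families `P_m^k` (first argument `k`, second argument `m`), obtained by unfolding the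
recursion for `Γ_k` and sorting the terms by the number of factors `1/(k + 1 - iλ)`. Terms with a
vanishing coefficient are left out, since they are not reciprocals of polynomials. -/
noncomputable def hcPoly (α β : ℝ) : ℕ → ℕ → Multiset (Polynomial ℂ)
  | 0, m => if m = 0 then {1} else 0
  | k + 1, m => ∑ j : Fin (k + 1),
      ((hcPoly α β j m).map (fun f =>
          Polynomial.C ((((k : ℝ) + 1) / hcWeight α β (k + 1 - j) : ℝ) : ℂ) * f)
        + if m = 0 ∨ hcShift α β k j = 0 then 0 else
          (hcPoly α β j (m - 1)).map (fun f =>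
            Polynomial.C
                ((((k : ℝ) + 1) / (hcWeight α β (k + 1 - j) * hcShift α β k j) : ℝ) : ℂ) *
              ((Polynomial.C (-Complex.I) * Polynomial.X + Polynomial.C ((k : ℂ) + 1)) * f)))

/-- A family `x_m^k` solves the graded form of the recursion for `Γ_k`: each factor
`1/(k + 1 - iλ)` raises `m` by one. Both the terms `γ_m^k` and the remainders `E_m^k` do. -/
structure IsGradedSolution (α β : ℝ) (lam : ℂ) (x : ℕ → ℕ → ℂ) : Prop where
  zero : ∀ m, x (m + 1) 0 = 0
  succ : ∀ m k, x (m + 1) (k + 1) = (∑ j ∈ Finset.range (k + 1),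
    (hcWeight α β (k + 1 - j) : ℂ) *
      (x (m + 1) j + (hcShift α β k j : ℂ) / ((k : ℂ) + 1 - Complex.I * lam) * x m j)) /
      ((k : ℂ) + 1)

section

variable {α β : ℝ} {lam : ℂ}

lemma hcCoeff_zero : hcCoeff α β lam 0 = 1 := by rw [hcCoeff]

/-- Both sums of the defining recursion combined into one. -/
lemma hcCoeff_succ (k : ℕ) : hcCoeff α β lam (k + 1) =
    (∑ j ∈ Finset.range (k + 1), (hcWeight α β (k + 1 - j) : ℂ) *
      (((jacobiRho α β : ℂ) + 2 * (j : ℂ) - Complex.I * lam) * hcCoeff α β lam j)) /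
      (((k : ℂ) + 1) * ((k : ℂ) + 1 - Complex.I * lam)) := by
  have key : ∀ g : ℕ → ℂ, ∑ i : Fin ((k + 1) / 2), g (k + 1 - 2 * ((i : ℕ) + 1)) =
      ∑ j ∈ Finset.range (k + 1), if Even (k + 1 - j) then g j else 0 := by
    intro g
    rw [Fin.sum_univ_eq_sum_range (fun i => g (k + 1 - 2 * (i + 1))) ((k + 1) / 2),
      ← Finset.sum_filter]
    refine Finset.sum_nbij' (fun i => k + 1 - 2 * (i + 1)) (fun j => (k + 1 - j) / 2 - 1)
      ?_ ?_ ?_ ?_ ?_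
    · intro i hi
      simp only [Finset.mem_range, Finset.mem_filter] at hi ⊢
      exact ⟨by omega, i + 1, by omega⟩
    · intro j hj
      simp only [Finset.mem_range, Finset.mem_filter] at hj ⊢
      obtain ⟨h1, r, h2⟩ := hj
      omega
    · intro i hi
      simp only [Finset.mem_range] at hi
      omega
    · intro j hj
      simp only [Finset.mem_range, Finset.mem_filter] at hj
      obtain ⟨h1, r, h2⟩ := hj
      omega
    · intro i _; rfl
  rw [hcCoeff]
  congr 1
  rw [key fun j => ((jacobiRho α β : ℂ) + 2 * (j : ℂ) - Complex.I * lam) * hcCoeff α β lam j,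
    Fin.sum_univ_eq_sum_range (fun j => ((jacobiRho α β : ℂ) + 2 * (j : ℂ) - Complex.I * lam) *
      hcCoeff α β lam j), Finset.mul_sum, Finset.mul_sum, ← Finset.sum_add_distrib]
  refine Finset.sum_congr rfl fun j _ => ?_
  unfold hcWeight
  split_ifs
  · simp only [jacobiRho]; push_cast; ring
  · ring

lemma hcCoeff_succ' (k : ℕ) (h : (k : ℂ) + 1 - Complex.I * lam ≠ 0) :
    hcCoeff α β lam (k + 1) =
    (∑ j ∈ Finset.range (k + 1), (hcWeight α β (k + 1 - j) : ℂ) *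
      (hcCoeff α β lam j +
        (hcShift α β k j : ℂ) / ((k : ℂ) + 1 - Complex.I * lam) * hcCoeff α β lam j)) /
      ((k : ℂ) + 1) := by
  rw [hcCoeff_succ, mul_comm ((k : ℂ) + 1), ← div_div, Finset.sum_div]
  congr 1
  refine Finset.sum_congr rfl fun j _ => ?_
  rw [hcShift]
  field_simp
  push_cast; ring

lemma hcWeight_pos (hβα : β < α) (hρ : 0 < jacobiRho α β) (n : ℕ) : 0 < hcWeight α β n := by
  unfold hcWeight; split_ifs <;> linarith

lemma hcWeight_le (hβ : -(1 / 2) < β) (n : ℕ) : hcWeight α β n ≤ jacobiRho α β := by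
  unfold hcWeight; split_ifs
  · exact le_rfl
  · unfold jacobiRho; linarith

lemma recipSum_zero : recipSum 0 lam = 0 := by simp [recipSum]

lemma recipSum_add (P Q : Multiset (Polynomial ℂ)) :
    recipSum (P + Q) lam = recipSum P lam + recipSum Q lam := by simp [recipSum]

lemma recipSum_sum {ι : Type*} (s : Finset ι) (P : ι → Multiset (Polynomial ℂ)) :
    recipSum (∑ i ∈ s, P i) lam = ∑ i ∈ s, recipSum (P i) lam := by
  classical
  induction s using Finset.induction_on with
  | empty => simp [recipSum]
  | insert i s hi ih => rw [Finset.sum_insert hi, Finset.sum_insert hi, recipSum_add, ih]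

lemma recipSum_map_mul (P : Multiset (Polynomial ℂ)) (g : Polynomial ℂ) :
    recipSum (P.map fun f => g * f) lam = (g.eval lam)⁻¹ * recipSum P lam := by
  unfold recipSum
  rw [Multiset.map_map, ← Multiset.sum_map_mul_left]
  refine congrArg Multiset.sum (Multiset.map_congr rfl fun f _ => ?_)
  simp [mul_comm]

lemma recipSum_hcPoly_succ (k m : ℕ) : recipSum (hcPoly α β (k + 1) (m + 1)) lam =
    (∑ j ∈ Finset.range (k + 1), (hcWeight α β (k + 1 - j) : ℂ) *
      (recipSum (hcPoly α β j (m + 1)) lam +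
        (hcShift α β k j : ℂ) / ((k : ℂ) + 1 - Complex.I * lam) *
          recipSum (hcPoly α β j m) lam)) / ((k : ℂ) + 1) := by
  rw [hcPoly, recipSum_sum, Finset.sum_div, ← Fin.sum_univ_eq_sum_range (fun j =>
    (hcWeight α β (k + 1 - j) : ℂ) * (recipSum (hcPoly α β j (m + 1)) lam +
        (hcShift α β k j : ℂ) / ((k : ℂ) + 1 - Complex.I * lam) *
          recipSum (hcPoly α β j m) lam) / ((k : ℂ) + 1))]
  refine Finset.sum_congr rfl fun j _ => ?_
  have hl : -Complex.I * lam + ((k : ℂ) + 1) = (k : ℂ) + 1 - Complex.I * lam := by ring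
  rw [recipSum_add, recipSum_map_mul]
  by_cases hw : hcShift α β k j = 0
  · simp only [hw, or_true, if_true, recipSum_zero, Polynomial.eval_C]
    push_cast; rw [inv_div]; ring
  · simp only [hw, Nat.add_one_ne_zero, or_false, if_false, Nat.add_sub_cancel,
      ← mul_assoc (Polynomial.C (_ : ℂ)), recipSum_map_mul, Polynomial.eval_C,
      Polynomial.eval_mul, Polynomial.eval_add, Polynomial.eval_X, hl]
    push_cast; rw [mul_inv, inv_div, inv_div]; ring

lemma recipSum_hcPoly_succ_zero (k : ℕ) : recipSum (hcPoly α β (k + 1) 0) lam =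
    (∑ j ∈ Finset.range (k + 1), (hcWeight α β (k + 1 - j) : ℂ) *
      recipSum (hcPoly α β j 0) lam) / ((k : ℂ) + 1) := by
  rw [hcPoly, recipSum_sum, Finset.sum_div, ← Fin.sum_univ_eq_sum_range (fun j =>
    (hcWeight α β (k + 1 - j) : ℂ) * recipSum (hcPoly α β j 0) lam / ((k : ℂ) + 1))]
  refine Finset.sum_congr rfl fun j _ => ?_
  rw [recipSum_add, recipSum_map_mul]
  simp only [true_or, if_true, recipSum_zero, Polynomial.eval_C]
  push_cast; rw [inv_div]; ring

lemma isGradedSolution_recipSum :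
    IsGradedSolution α β lam fun m k => recipSum (hcPoly α β k m) lam where
  zero m := by simp [hcPoly, recipSum_zero]
  succ m k := recipSum_hcPoly_succ k m

lemma recipSum_hcPoly_zero_zero : recipSum (hcPoly α β 0 0) lam = 1 := by
  simp [hcPoly, recipSum]

/-- The remainder `E_M^k = Γ_k - ∑_{m<M} γ_m^k`. -/
noncomputable def hcError (α β : ℝ) (M k : ℕ) (lam : ℂ) : ℂ :=
  hcCoeff α β lam k - ∑ m ∈ Finset.range M, recipSum (hcPoly α β k m) lam

lemma isGradedSolution_hcError (h : ∀ k : ℕ, (k : ℂ) + 1 - Complex.I * lam ≠ 0) :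
    IsGradedSolution α β lam fun M k => hcError α β M k lam where
  zero M := by
    have : ∀ m, recipSum (hcPoly α β 0 (m + 1)) lam = 0 := isGradedSolution_recipSum.zero
    simp [hcError, hcCoeff_zero, Finset.sum_range_succ', this, recipSum_hcPoly_zero_zero]
  succ M k := by
    simp only [hcError]
    rw [hcCoeff_succ' k (h k), Finset.sum_range_succ' (fun m => recipSum (hcPoly α β (k + 1) m) lam),
      recipSum_hcPoly_succ_zero]
    simp only [recipSum_hcPoly_succ]
    rw [← Finset.sum_div, ← add_div, ← sub_div, Finset.sum_comm, ← Finset.sum_add_distrib,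
      ← Finset.sum_sub_distrib]
    congr 1
    refine Finset.sum_congr rfl fun j _ => ?_
    rw [← Finset.mul_sum, Finset.sum_add_distrib, ← Finset.mul_sum,
      Finset.sum_range_succ' (fun m => recipSum (hcPoly α β j m) lam)]
    ring

lemma IsGradedSolution.eq_zero_of_lt {x : ℕ → ℕ → ℂ} (hx : IsGradedSolution α β lam x) :
    ∀ k m : ℕ, k < m → x m k = 0 := by
  intro k
  induction k using Nat.strong_induction_on with
  | _ k ih =>
    intro m hm
    obtain ⟨m, rfl⟩ := Nat.exists_eq_succ_of_ne_zero (Nat.ne_zero_of_lt hm)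
    cases k with
    | zero => exact hx.zero m
    | succ k =>
      rw [hx.succ, Finset.sum_eq_zero, zero_div]
      intro j hj
      have := Finset.mem_range.1 hj
      rw [ih j this _ (by omega), ih j this _ (by omega)]
      simp

lemma norm_natCast_add_one (k : ℕ) : ‖(k : ℂ) + 1‖ = (k : ℝ) + 1 := by
  rw [← Nat.cast_add_one, Complex.norm_natCast]; push_cast; rfl

/-- A solution of the ungraded recursion with coefficients `p_{k,j}` of size at most
`δ(k+1) + K` is dominated by `growthBound δ K`. -/
lemma norm_le_growthBound {δ K : ℝ} {y : ℕ → ℂ} {p : ℕ → ℕ → ℂ} (h0 : ‖y 0‖ ≤ 1)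
    (hp : ∀ k j : ℕ, j ≤ k → ‖p k j‖ ≤ δ * ((k : ℝ) + 1) + K)
    (hy : ∀ k, y (k + 1) = (∑ j ∈ Finset.range (k + 1), p k j * y j) / ((k : ℂ) + 1)) (k : ℕ) :
    ‖y k‖ ≤ growthBound δ K k := by
  induction k using Nat.strong_induction_on with
  | _ k ih =>
    cases k with
    | zero => simpa [growthBound] using h0
    | succ k =>
      rw [hy, norm_div, norm_natCast_add_one, growthBound_succ]
      gcongr
      refine norm_sum_le_of_le _ fun j hj => ?_
      have hj' := Finset.mem_range.1 hj
      rw [norm_mul]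
      exact mul_le_mul (hp k j (by omega)) (ih j hj') (norm_nonneg _)
        ((norm_nonneg _).trans (hp k j (by omega)))

/-- The normalised quantities `|x_m^k| / r^m` satisfy the ungraded recursive inequality in which
each factor `(ρ + 2j - (k + 1)) / (k + 1 - iλ)` is divided by `r`. Here `r = 1` gives bounds in a
half-plane, and `r = ρ / |Re λ|` gives the decay in `m`. -/
lemma IsGradedSolution.norm_le {x : ℕ → ℕ → ℂ} (hx : IsGradedSolution α β lam x) {r δ K : ℝ}
    (hδ : 0 ≤ δ) (hK : 0 ≤ K) (hr : 0 < r) (hc : ∀ n, 0 ≤ hcWeight α β n)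
    (hp : ∀ k j : ℕ, j ≤ k → hcWeight α β (k + 1 - j) *
      (1 + |hcShift α β k j| / ‖(k : ℂ) + 1 - Complex.I * lam‖ / r) ≤ δ * ((k : ℝ) + 1) + K)
    (h0 : ∀ k, ‖x 0 k‖ ≤ growthBound δ K k) :
    ∀ k m : ℕ, ‖x m k‖ ≤ growthBound δ K k * r ^ m := by
  intro k
  induction k using Nat.strong_induction_on with
  | _ k ih =>
    intro m
    cases m with
    | zero => simpa using h0 k
    | succ m =>
      cases k with
      | zero => rw [hx.zero]; simp [growthBound]; positivity
      | succ k =>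
        rw [hx.succ, norm_div, norm_natCast_add_one, growthBound_succ, div_mul_eq_mul_div,
          Finset.sum_mul]
        gcongr
        refine norm_sum_le_of_le _ fun j hj => ?_
        have hj' := Finset.mem_range.1 hj
        have hB := growthBound_nonneg hδ hK j
        rw [norm_mul, Complex.norm_real, Real.norm_of_nonneg (hc _)]
        calc hcWeight α β (k + 1 - j) * ‖x (m + 1) j +
                (hcShift α β k j : ℂ) / ((k : ℂ) + 1 - Complex.I * lam) * x m j‖
            ≤ hcWeight α β (k + 1 - j) * (growthBound δ K j * r ^ (m + 1) +
                |hcShift α β k j| / ‖(k : ℂ) + 1 - Complex.I * lam‖ *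
                  (growthBound δ K j * r ^ m)) := by
              refine mul_le_mul_of_nonneg_left (norm_add_le_of_le (ih j hj' _) ?_) (hc _)
              rw [norm_mul, norm_div, Complex.norm_real, Real.norm_eq_abs]
              exact mul_le_mul_of_nonneg_left (ih j hj' m) (by positivity)
          _ = hcWeight α β (k + 1 - j) *
                (1 + |hcShift α β k j| / ‖(k : ℂ) + 1 - Complex.I * lam‖ / r) *
                growthBound δ K j * r ^ (m + 1) := by
              field_simp
              ring
          _ ≤ _ := by
              gcongr
              exact hp k j (by omega)

end

/-! ### Bounds on the coefficients -/

section

variable {α β : ℝ} {lam : ℂ}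

/-- A constant `K` with `|Γ_k| ≤ growthBound 0 K k` in the half-plane `Im λ > -1/2`. -/
noncomputable def hcGrowth (α β : ℝ) : ℝ := jacobiRho α β * (3 + 2 * jacobiRho α β)

lemma half_le_norm_sub (h : -(1 / 2) < lam.im) (k : ℕ) :
    ((k : ℝ) + 1) / 2 ≤ ‖(k : ℂ) + 1 - Complex.I * lam‖ := by
  have h1 : ((k : ℂ) + 1 - Complex.I * lam).re = (k : ℝ) + 1 + lam.im := by simp
  have h2 := (le_abs_self _).trans (Complex.abs_re_le_norm ((k : ℂ) + 1 - Complex.I * lam))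
  have : (0 : ℝ) ≤ k := k.cast_nonneg
  rw [h1] at h2; linarith

lemma abs_re_le_norm_sub (k : ℕ) : |lam.re| ≤ ‖(k : ℂ) + 1 - Complex.I * lam‖ := by
  have h1 : ((k : ℂ) + 1 - Complex.I * lam).im = -lam.re := by simp
  have h2 := Complex.abs_im_le_norm ((k : ℂ) + 1 - Complex.I * lam)
  rwa [h1, abs_neg] at h2

lemma sub_ne_zero_of_im (h : -(1 / 2) < lam.im) (k : ℕ) :
    (k : ℂ) + 1 - Complex.I * lam ≠ 0 :=
  norm_pos_iff.1 (lt_of_lt_of_le (by positivity) (half_le_norm_sub h k))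

lemma sub_ne_zero_of_re (h : lam.re ≠ 0) (k : ℕ) :
    (k : ℂ) + 1 - Complex.I * lam ≠ 0 :=
  norm_pos_iff.1 (lt_of_lt_of_le (abs_pos.2 h) (abs_re_le_norm_sub k))

lemma abs_hcShift_le (hρ : 0 < jacobiRho α β) {k j : ℕ} (hj : j ≤ k) :
    |hcShift α β k j| ≤ jacobiRho α β + (k + 1) := by
  have h1 : (j : ℝ) ≤ k := by exact_mod_cast hj
  have h2 : (0 : ℝ) ≤ j := j.cast_nonneg
  rw [hcShift, abs_le]
  constructor <;> linarith

lemma hcGrowth_pos (hρ : 0 < jacobiRho α β) : 0 < hcGrowth α β := by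
  unfold hcGrowth; positivity

lemma weight_le_of_im (hβα : β < α) (hβ : -(1 / 2) < β) (hρ : 0 < jacobiRho α β)
    (h : -(1 / 2) < lam.im) {k j : ℕ} (hj : j ≤ k) :
    hcWeight α β (k + 1 - j) * (1 + |hcShift α β k j| / ‖(k : ℂ) + 1 - Complex.I * lam‖)
      ≤ hcGrowth α β := by
  have h1 := half_le_norm_sub h k
  have hk : (0 : ℝ) ≤ k := k.cast_nonneg
  have hq : |hcShift α β k j| / ‖(k : ℂ) + 1 - Complex.I * lam‖ ≤ 2 + 2 * jacobiRho α β := by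
    rw [div_le_iff₀ (lt_of_lt_of_le (by positivity) h1)]
    calc |hcShift α β k j| ≤ jacobiRho α β + (k + 1) := abs_hcShift_le hρ hj
      _ ≤ (2 + 2 * jacobiRho α β) * (((k : ℝ) + 1) / 2) := by nlinarith
      _ ≤ _ := by gcongr
  have hw := hcWeight_le hβ (α := α) (k + 1 - j)
  have hw0 := hcWeight_pos hβα hρ (k + 1 - j)
  unfold hcGrowth
  exact mul_le_mul hw (by linarith) (by positivity) hρ.le

lemma weight_le_of_re (hβ : -(1 / 2) < β) (hρ : 0 < jacobiRho α β)
    (h : lam.re ≠ 0) {k j : ℕ} (hj : j ≤ k) :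
    hcWeight α β (k + 1 - j) * (1 + |hcShift α β k j| / ‖(k : ℂ) + 1 - Complex.I * lam‖ /
      (jacobiRho α β / |lam.re|)) ≤ 1 * ((k : ℝ) + 1) + hcGrowth α β := by
  have hr := abs_pos.2 h
  have hq : |hcShift α β k j| / ‖(k : ℂ) + 1 - Complex.I * lam‖ / (jacobiRho α β / |lam.re|) ≤
      (jacobiRho α β + (k + 1)) / jacobiRho α β := by
    calc |hcShift α β k j| / ‖(k : ℂ) + 1 - Complex.I * lam‖ / (jacobiRho α β / |lam.re|)
        ≤ (jacobiRho α β + (k + 1)) / |lam.re| / (jacobiRho α β / |lam.re|) := by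
          gcongr
          · exact abs_hcShift_le hρ hj
          · exact abs_re_le_norm_sub k
      _ = _ := by field_simp
  have hw := hcWeight_le hβ (α := α) (k + 1 - j)
  calc _ ≤ jacobiRho α β * (1 + (jacobiRho α β + (k + 1)) / jacobiRho α β) :=
        mul_le_mul hw (by linarith) (by positivity) hρ.le
    _ = 2 * jacobiRho α β + (k + 1) := by field_simp; ring
    _ ≤ _ := by unfold hcGrowth; nlinarith

lemma norm_hcCoeff_le (hβα : β < α) (hβ : -(1 / 2) < β) (hρ : 0 < jacobiRho α β)
    (h : -(1 / 2) < lam.im) (k : ℕ) :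
    ‖hcCoeff α β lam k‖ ≤ growthBound 0 (hcGrowth α β) k := by
  refine norm_le_growthBound (p := fun k j => (hcWeight α β (k + 1 - j) : ℂ) *
    (1 + (hcShift α β k j : ℂ) / ((k : ℂ) + 1 - Complex.I * lam))) (by simp [hcCoeff_zero])
    (fun k j hj => ?_) (fun k => ?_) k
  · rw [norm_mul, Complex.norm_real, Real.norm_of_nonneg (hcWeight_pos hβα hρ _).le, zero_mul,
      zero_add]
    refine le_trans (mul_le_mul_of_nonneg_left ?_ (hcWeight_pos hβα hρ _).le)
      (weight_le_of_im hβα hβ hρ h hj)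
    refine norm_add_le_of_le norm_one.le ?_
    rw [norm_div, Complex.norm_real, Real.norm_eq_abs]
  · rw [hcCoeff_succ' k (sub_ne_zero_of_im h k)]
    congr 1
    exact Finset.sum_congr rfl fun j _ => by ring

lemma norm_recipSum_hcPoly_zero_le (hβα : β < α) (hβ : -(1 / 2) < β) (hρ : 0 < jacobiRho α β)
    (k : ℕ) : ‖recipSum (hcPoly α β k 0) lam‖ ≤ growthBound 0 (hcGrowth α β) k := by
  refine norm_le_growthBound (y := fun k => recipSum (hcPoly α β k 0) lam)
    (p := fun k j => (hcWeight α β (k + 1 - j) : ℂ))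
    (by simp [recipSum_hcPoly_zero_zero]) (fun k j _ => ?_) recipSum_hcPoly_succ_zero k
  rw [Complex.norm_real, Real.norm_of_nonneg (hcWeight_pos hβα hρ _).le]
  refine (hcWeight_le hβ _).trans ?_
  unfold hcGrowth; nlinarith

lemma IsGradedSolution.norm_le_of_im {x : ℕ → ℕ → ℂ} (hx : IsGradedSolution α β lam x)
    (hβα : β < α) (hβ : -(1 / 2) < β) (hρ : 0 < jacobiRho α β) (h : -(1 / 2) < lam.im)
    (h0 : ∀ k, ‖x 0 k‖ ≤ growthBound 0 (hcGrowth α β) k) (m k : ℕ) :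
    ‖x m k‖ ≤ growthBound 0 (hcGrowth α β) k := by
  have := hx.norm_le le_rfl (hcGrowth_pos hρ).le one_pos (fun n => (hcWeight_pos hβα hρ n).le)
    (fun _ _ hj => by simpa using weight_le_of_im hβα hβ hρ h hj) h0 k m
  simpa using this

lemma IsGradedSolution.norm_le_of_re {x : ℕ → ℕ → ℂ} (hx : IsGradedSolution α β lam x)
    (hβα : β < α) (hβ : -(1 / 2) < β) (hρ : 0 < jacobiRho α β) (h : lam.re ≠ 0)
    (h0 : ∀ k, ‖x 0 k‖ ≤ growthBound 0 (hcGrowth α β) k) (m k : ℕ) :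
    ‖x m k‖ ≤ growthBound 1 (hcGrowth α β) k * (jacobiRho α β / |lam.re|) ^ m :=
  hx.norm_le zero_le_one (hcGrowth_pos hρ).le (div_pos hρ (abs_pos.2 h))
    (fun n => (hcWeight_pos hβα hρ n).le) (fun _ _ hj => weight_le_of_re hβ hρ h hj)
    (fun k => (h0 k).trans
      (growthBound_mono_left le_rfl (hcGrowth_pos hρ).le zero_le_one k)) k m

lemma norm_hcError_zero_le (hβα : β < α) (hβ : -(1 / 2) < β) (hρ : 0 < jacobiRho α β)
    (h : -(1 / 2) < lam.im) (k : ℕ) :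
    ‖hcError α β 0 k lam‖ ≤ growthBound 0 (hcGrowth α β) k := by
  simpa [hcError] using norm_hcCoeff_le hβα hβ hρ h k

lemma absConvAbove_of_le_growthBound (hρ : 0 < jacobiRho α β) (m : ℕ) {c : ℕ → ℂ}
    (hc : ∀ j, ‖c j‖ ≤ growthBound 0 (hcGrowth α β) (m + j)) : AbsConvAbove 0 c :=
  AbsConvAbove.of_le hc fun _ hs => summable_growthBound_add_mul_exp (hcGrowth_pos hρ).le m hs

lemma absConvAbove_hcCoeff (hβα : β < α) (hβ : -(1 / 2) < β) (hρ : 0 < jacobiRho α β)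
    (h : -(1 / 2) < lam.im) : AbsConvAbove 0 (hcCoeff α β lam) :=
  absConvAbove_of_le_growthBound hρ 0 fun j => by simpa using norm_hcCoeff_le hβα hβ hρ h j

end

/-! ### The differential equation -/

lemma tendsto_dirichletSum_atTop {σ : ℝ} {c : ℕ → ℂ} (h : AbsConvAbove σ c) :
    Filter.Tendsto (dirichletSum c) Filter.atTop (𝓝 (c 0)) := by
  have hlim : ∑' j : ℕ, (if j = 0 then c 0 else 0) = c 0 := tsum_ite_eq 0 fun _ => c 0
  rw [← hlim]
  refine tendsto_tsum_of_dominated_convergence (h (σ + 1) (by linarith)) (fun j => ?_) ?_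
  · rcases Nat.eq_zero_or_pos j with rfl | hj
    · simp
    · rw [if_neg hj.ne']
      have h1 : Filter.Tendsto (fun t : ℝ => Real.exp (-(2 * (j : ℝ) * t))) Filter.atTop (𝓝 0) :=
        Real.tendsto_exp_neg_atTop_nhds_zero.comp
          (Filter.tendsto_id.const_mul_atTop (by positivity))
      have h2 := ((Complex.continuous_ofReal.tendsto _).comp h1).const_mul (c j)
      simpa using h2
  · filter_upwards [Filter.eventually_ge_atTop (σ + 1)] with t ht j
    rw [norm_dirichlet_term]
    gcongr

lemma AbsConvAbove.sub_mul {σ : ℝ} {c : ℕ → ℂ} (h : AbsConvAbove σ c) (μ : ℂ) :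
    AbsConvAbove σ fun j => (μ - 2 * (j : ℂ)) * c j := by
  refine AbsConvAbove.of_le (B := fun j => ‖μ‖ * ‖c j‖ + ‖c j * (-(2 * (j : ℂ))) ^ 1‖)
    (fun j => ?_) fun s hs => ?_
  · rw [show (μ - 2 * (j : ℂ)) * c j = μ * c j + c j * (-(2 * (j : ℂ))) ^ 1 by ring]
    exact norm_add_le_of_le (norm_mul_le _ _) le_rfl
  · simpa only [add_mul, mul_assoc] using
      ((h s hs).mul_left ‖μ‖).add (h.mul_pow 1 s hs)

/-- Differentiation of `e^{μt} ∑_j c_j e^{-2jt}` multiplies the coefficients by `μ - 2j`. -/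
lemma AbsConvAbove.hasDerivAt_exp_mul {σ : ℝ} {c : ℕ → ℂ} (h : AbsConvAbove σ c) (μ : ℂ) {t : ℝ}
    (ht : σ < t) :
    HasDerivAt (fun s : ℝ => Complex.exp (μ * (s : ℂ)) * dirichletSum c s)
      (Complex.exp (μ * (t : ℂ)) * dirichletSum (fun j => (μ - 2 * (j : ℂ)) * c j) t) t := by
  have h1 : HasDerivAt (fun s : ℝ => Complex.exp (μ * (s : ℂ)))
      (Complex.exp (μ * (t : ℂ)) * (μ * 1)) t :=
    (((hasDerivAt_id (t : ℂ)).const_mul μ).cexp).comp_ofReal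
  refine (h1.mul (h.hasDerivAt ht)).congr_deriv ?_
  have h2 : AbsConvAbove σ fun j => c j * (-(2 * (j : ℂ))) := by simpa using h.mul_pow 1
  have h3 : dirichletSum (fun j => (μ - 2 * (j : ℂ)) * c j) t =
      μ * dirichletSum c t + dirichletSum (fun j => c j * (-(2 * (j : ℂ)))) t := by
    refine ((h.sub_mul μ).hasSum ht).unique ?_
    refine (((h.hasSum ht).mul_left μ).add (h2.hasSum ht)).congr_fun fun j => ?_
    ring
  rw [h3]; ring

/-- The coefficients of `(2α+1) coth t + (2β+1) tanh t` as a power series in `e^{-2t}`. -/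
noncomputable def driftCoeff (α β : ℝ) (n : ℕ) : ℝ :=
  if n = 0 then 2 * jacobiRho α β else 4 * hcWeight α β n

lemma exp_neg_two_mul_nat (k : ℕ) (t : ℝ) :
    Real.exp (-(2 * (k : ℝ) * t)) = Real.exp (-(2 * t)) ^ k := by
  rw [← Real.exp_nat_mul]; congr 1; ring

lemma cosh_div_sinh_eq {t : ℝ} (ht : 0 < t) : Real.cosh t / Real.sinh t =
    2 * (1 - Real.exp (-(2 * t)))⁻¹ - 1 := by
  have hx : Real.exp (-(2 * t)) < 1 := by rw [Real.exp_lt_one_iff]; linarith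
  have h1 : Real.exp (-(2 * t)) = (Real.exp t)⁻¹ ^ 2 := by
    rw [← Real.exp_neg, ← Real.exp_nat_mul]; congr 1; push_cast; ring
  have he := Real.exp_pos t
  have hs : Real.sinh t ≠ 0 := (Real.sinh_pos_iff.2 ht).ne'
  have hne : 1 - Real.exp (-(2 * t)) ≠ 0 := by linarith
  rw [Real.sinh_eq, Real.exp_neg] at hs
  rw [Real.cosh_eq, Real.sinh_eq, Real.exp_neg]
  rw [h1] at hne ⊢
  have hs' : Real.exp t - (Real.exp t)⁻¹ ≠ 0 := fun h => hs (by rw [h]; simp)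
  generalize Real.exp t = x at *
  have hx2 : x ^ 2 - 1 ≠ 0 := fun h => hs' (by field_simp; linarith)
  field_simp
  ring

lemma tanh_eq_inv (t : ℝ) : Real.tanh t = 2 * (1 + Real.exp (-(2 * t)))⁻¹ - 1 := by
  have h1 : Real.exp (-(2 * t)) = (Real.exp t)⁻¹ ^ 2 := by
    rw [← Real.exp_neg, ← Real.exp_nat_mul]; congr 1; push_cast; ring
  have he := Real.exp_pos t
  rw [Real.tanh_eq_sinh_div_cosh, Real.cosh_eq, Real.sinh_eq, Real.exp_neg, h1]
  field_simp
  ring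

lemma hasSum_driftCoeff (α β : ℝ) {t : ℝ} (ht : 0 < t) :
    HasSum (fun n : ℕ => driftCoeff α β n * Real.exp (-(2 * (n : ℝ) * t)))
      ((2 * α + 1) * (Real.cosh t / Real.sinh t) + (2 * β + 1) * Real.tanh t) := by
  have hx : Real.exp (-(2 * t)) < 1 := by rw [Real.exp_lt_one_iff]; linarith
  have hx0 := Real.exp_pos (-(2 * t))
  have h1 := (hasSum_geometric_of_lt_one hx0.le hx).mul_left (2 * (2 * α + 1))
  have h2 := (hasSum_geometric_of_abs_lt_one (r := -Real.exp (-(2 * t)))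
    (by rwa [abs_neg, abs_of_pos hx0])).mul_left (2 * (2 * β + 1))
  have h3 := hasSum_ite_eq (0 : ℕ) (2 * jacobiRho α β)
  have h4 := (h1.add h2).sub h3
  have hval : (2 * α + 1) * (Real.cosh t / Real.sinh t) + (2 * β + 1) * Real.tanh t =
      2 * (2 * α + 1) * (1 - Real.exp (-(2 * t)))⁻¹ +
        2 * (2 * β + 1) * (1 - -Real.exp (-(2 * t)))⁻¹ - 2 * jacobiRho α β := by
    rw [cosh_div_sinh_eq ht, tanh_eq_inv, sub_neg_eq_add, jacobiRho]; ring
  rw [hval]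
  refine h4.congr_fun fun n => ?_
  · rw [exp_neg_two_mul_nat, driftCoeff, neg_pow (Real.exp _)]
    rcases Nat.eq_zero_or_pos n with rfl | hn
    · simp [jacobiRho]; ring
    · rw [if_neg hn.ne', if_neg hn.ne', hcWeight]
      split_ifs with he
      · rw [he.neg_one_pow, jacobiRho]; ring
      · rw [(Nat.not_even_iff_odd.1 he).neg_one_pow]; ring

section

variable {α β : ℝ} {lam : ℂ}

/-- The recursion for `Γ_k` is the vanishing of the coefficients of the differential equation. -/
lemma hcCoeff_drift (h : ∀ k : ℕ, (k : ℂ) + 1 - Complex.I * lam ≠ 0) {μ : ℂ}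
    (hμ : μ = Complex.I * lam - (jacobiRho α β : ℂ)) (k : ℕ) :
    (μ - 2 * (k : ℂ)) * ((μ - 2 * (k : ℂ)) * hcCoeff α β lam k) +
      (∑ p ∈ Finset.HasAntidiagonal.antidiagonal k,
        (μ - 2 * (p.1 : ℂ)) * hcCoeff α β lam p.1 * (driftCoeff α β p.2 : ℂ)) +
      (lam ^ 2 + (jacobiRho α β : ℂ) ^ 2) * hcCoeff α β lam k = 0 := by
  have hI : Complex.I ^ 2 = -1 := Complex.I_sq
  rw [Finset.Nat.sum_antidiagonal_eq_sum_range_succ_mk, Finset.sum_range_succ]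
  have h0 : (driftCoeff α β (k - k) : ℂ) = 2 * (jacobiRho α β : ℂ) := by simp [driftCoeff]
  cases k with
  | zero =>
    simp only [Finset.range_zero, Finset.sum_empty, hcCoeff_zero, h0, hμ]
    push_cast
    linear_combination lam ^ 2 * hI
  | succ k =>
    have hsum : ∑ j ∈ Finset.range (k + 1), (μ - 2 * (j : ℂ)) * hcCoeff α β lam j *
        (driftCoeff α β (k + 1 - j) : ℂ) = -4 * ∑ j ∈ Finset.range (k + 1),
          (hcWeight α β (k + 1 - j) : ℂ) *
          (((jacobiRho α β : ℂ) + 2 * (j : ℂ) - Complex.I * lam) * hcCoeff α β lam j) := by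
      rw [Finset.mul_sum]
      refine Finset.sum_congr rfl fun j hj => ?_
      have hj' := Finset.mem_range.1 hj
      rw [driftCoeff, if_neg (by omega), hμ]; push_cast; ring
    have hrec := hcCoeff_succ (α := α) (β := β) (lam := lam) k
    have hk : (k : ℂ) + 1 ≠ 0 := by exact_mod_cast Nat.succ_ne_zero k
    rw [eq_div_iff (mul_ne_zero hk (h k))] at hrec
    rw [hsum, ← hrec, h0, hμ]
    push_cast
    linear_combination lam ^ 2 * hcCoeff α β lam (k + 1) * hI

/-- The Harish-Chandra series times `e^{(iλ-ρ)t}` solves the Jacobi equation, with leading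
coefficient `Γ_0 = 1` at infinity. -/
lemma isJacobiSolutionAtInfinity_hcSeries (hΓ : AbsConvAbove 0 (hcCoeff α β lam))
    (h : ∀ k : ℕ, (k : ℂ) + 1 - Complex.I * lam ≠ 0) :
    IsJacobiSolutionAtInfinity α β lam fun t : ℝ =>
      Complex.exp ((Complex.I * lam - (jacobiRho α β : ℂ)) * (t : ℂ)) * hcSeries α β lam t := by
  set μ : ℂ := Complex.I * lam - (jacobiRho α β : ℂ) with hμ
  have hser : hcSeries α β lam = dirichletSum (hcCoeff α β lam) := rfl
  rw [hser]
  have hΓ1 := hΓ.sub_mul μ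
  have hΓ2 := hΓ1.sub_mul μ
  refine ⟨?_, fun t ht => ?_, ?_⟩
  · refine ContDiffOn.mul ?_ (contDiffOn_infty.1 hΓ.contDiffOn 2)
    have : ContDiff ℝ 2 fun t : ℝ => Complex.exp (μ * (t : ℂ)) :=
      (contDiff_const.mul Complex.ofRealCLM.contDiff).cexp
    exact this.contDiffOn
  · have d1 : deriv (fun s : ℝ => Complex.exp (μ * (s : ℂ)) * dirichletSum (hcCoeff α β lam) s)
        =ᶠ[𝓝 t] fun s : ℝ => Complex.exp (μ * (s : ℂ)) *
          dirichletSum (fun j => (μ - 2 * (j : ℂ)) * hcCoeff α β lam j) s := by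
      filter_upwards [isOpen_Ioi.mem_nhds ht] with s hs using (hΓ.hasDerivAt_exp_mul μ hs).deriv
    have hω : HasSum (fun n : ℕ =>
        (driftCoeff α β n : ℂ) * (Real.exp (-(2 * (n : ℝ) * t)) : ℂ))
        (((2 * α + 1) * (Real.cosh t / Real.sinh t) + (2 * β + 1) * Real.tanh t : ℝ) : ℂ) := by
      exact_mod_cast (Complex.hasSum_ofReal.2 (hasSum_driftCoeff α β ht))
    have hωn : Summable fun n : ℕ =>
        ‖(driftCoeff α β n : ℂ) * (Real.exp (-(2 * (n : ℝ) * t)) : ℂ)‖ := by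
      have := (hasSum_driftCoeff α β ht).summable.norm
      refine this.congr fun n => ?_
      rw [← Complex.ofReal_mul, Complex.norm_real]
    have hprod := (summable_norm_sum_mul_antidiagonal_of_summable_norm
      (hΓ1.summable_norm ht) hωn).of_norm.hasSum
    rw [← tsum_mul_tsum_eq_tsum_sum_antidiagonal_of_summable_norm (hΓ1.summable_norm ht) hωn,
      hω.tsum_eq, (hΓ1.hasSum ht).tsum_eq] at hprod
    have hzero := (((hΓ2.hasSum ht).add hprod).add ((hΓ.hasSum ht).mul_left
      (lam ^ 2 + (jacobiRho α β : ℂ) ^ 2))).unique (a₂ := 0) (by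
        refine hasSum_zero.congr_fun fun k => ?_
        have hx : ∀ p ∈ Finset.HasAntidiagonal.antidiagonal k,
            (μ - 2 * (p.1 : ℂ)) * hcCoeff α β lam p.1 *
              (Real.exp (-(2 * (p.1 : ℝ) * t)) : ℂ) *
              ((driftCoeff α β p.2 : ℂ) * (Real.exp (-(2 * (p.2 : ℝ) * t)) : ℂ)) =
            (μ - 2 * (p.1 : ℂ)) * hcCoeff α β lam p.1 * (driftCoeff α β p.2 : ℂ) *
              (Real.exp (-(2 * (k : ℝ) * t)) : ℂ) := by
          intro p hp
          rw [← Finset.HasAntidiagonal.mem_antidiagonal.1 hp]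
          have : Real.exp (-(2 * ((p.1 + p.2 : ℕ) : ℝ) * t)) =
              Real.exp (-(2 * (p.1 : ℝ) * t)) * Real.exp (-(2 * (p.2 : ℝ) * t)) := by
            rw [← Real.exp_add]; congr 1; push_cast; ring
          rw [this]; push_cast; ring
        rw [Finset.sum_congr rfl hx, ← Finset.sum_mul]
        linear_combination (Real.exp (-(2 * (k : ℝ) * t)) : ℂ) * hcCoeff_drift h hμ k)
    rw [jacobiLaplacian, iteratedDeriv_succ, iteratedDeriv_one, d1.deriv_eq,
      (hΓ1.hasDerivAt_exp_mul μ ht).deriv, d1.eq_of_nhds]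
    linear_combination Complex.exp (μ * (t : ℂ)) * hzero
  · have hlim := tendsto_dirichletSum_atTop hΓ
    rw [hcCoeff_zero] at hlim
    refine hlim.congr fun t => ?_
    rw [mul_div_cancel_left₀ _ (Complex.exp_ne_zero _)]

end

/-! ### The terms of the expansion -/

section

variable {α β : ℝ} {lam : ℂ}

lemma degree_hcPoly_and_eval_ne_zero (hβα : β < α) (hρ : 0 < jacobiRho α β) :
    ∀ k m : ℕ, ∀ f ∈ hcPoly α β k m, f.degree = (m : WithBot ℕ) ∧
      ∀ lam : ℂ, 0 ≤ lam.im → f.eval lam ≠ 0 := by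
  intro k
  induction k using Nat.strong_induction_on with
  | _ k ih =>
    intro m f hf
    cases k with
    | zero =>
      rw [hcPoly] at hf
      split_ifs at hf with hm
      · rw [Multiset.mem_singleton] at hf
        subst hf hm
        simp
      · simp at hf
    | succ k =>
      have hk : (k : ℝ) + 1 ≠ 0 := by positivity
      rw [hcPoly] at hf
      obtain ⟨j, -, hf⟩ := Multiset.mem_sum.1 hf
      have hw := (hcWeight_pos hβα hρ (k + 1 - j)).ne'
      rcases Multiset.mem_add.1 hf with hf | hf
      · obtain ⟨g, hg, rfl⟩ := Multiset.mem_map.1 hf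
        obtain ⟨h1, h2⟩ := ih j j.2 m g hg
        have hc : ((((k : ℝ) + 1) / hcWeight α β (k + 1 - j) : ℝ) : ℂ) ≠ 0 :=
          Complex.ofReal_ne_zero.2 (div_ne_zero hk hw)
        refine ⟨by rw [Polynomial.degree_C_mul hc, h1], fun lam hl => ?_⟩
        rw [Polynomial.eval_mul, Polynomial.eval_C]
        exact mul_ne_zero hc (h2 lam hl)
      · split_ifs at hf with hs
        · simp at hf
        · push Not at hs
          obtain ⟨g, hg, rfl⟩ := Multiset.mem_map.1 hf
          obtain ⟨h1, h2⟩ := ih j j.2 (m - 1) g hg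
          have hc : ((((k : ℝ) + 1) / (hcWeight α β (k + 1 - j) * hcShift α β k j) : ℝ) : ℂ) ≠ 0 :=
            Complex.ofReal_ne_zero.2 (div_ne_zero hk (mul_ne_zero hw hs.2))
          obtain ⟨m, rfl⟩ := Nat.exists_eq_succ_of_ne_zero hs.1
          refine ⟨?_, fun lam hl => ?_⟩
          · rw [Polynomial.degree_C_mul hc, Polynomial.degree_mul,
              Polynomial.degree_linear (neg_ne_zero.2 Complex.I_ne_zero), h1]
            push_cast [Nat.succ_eq_add_one, Nat.add_sub_cancel]
            rw [add_comm]
          · rw [Polynomial.eval_mul, Polynomial.eval_C, Polynomial.eval_mul]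
            refine mul_ne_zero hc (mul_ne_zero ?_ (h2 lam hl))
            have := sub_ne_zero_of_im (lam := lam) (by linarith) k
            simp only [Polynomial.eval_add, Polynomial.eval_mul, Polynomial.eval_C,
              Polynomial.eval_X]
            convert this using 1
            ring

/-- The term `γ_m^k`. -/
noncomputable def hcGamma (α β : ℝ) (m k : ℕ) (lam : ℂ) : ℂ :=
  recipSum (hcPoly α β k m) lam

lemma isGradedSolution_hcGamma : IsGradedSolution α β lam fun m k => hcGamma α β m k lam :=
  isGradedSolution_recipSum

lemma differentiableAt_hcGamma :
    ∀ k m : ℕ, ∀ z : ℂ, (∀ k : ℕ, (k : ℂ) + 1 - Complex.I * z ≠ 0) →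
      DifferentiableAt ℂ (hcGamma α β m k) z := by
  intro k
  induction k using Nat.strong_induction_on with
  | _ k ih =>
    intro m z hz
    cases k with
    | zero =>
      cases m with
      | zero =>
        have : hcGamma α β 0 0 = fun _ => 1 := funext fun _ => recipSum_hcPoly_zero_zero
        rw [this]; exact differentiableAt_const _
      | succ m =>
        have : hcGamma α β (m + 1) 0 = fun _ => 0 :=
          funext fun _ => isGradedSolution_hcGamma.zero m
        rw [this]; exact differentiableAt_const _
    | succ k =>
      cases m with
      | zero =>
        have : hcGamma α β 0 (k + 1) = fun z => (∑ j ∈ Finset.range (k + 1),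
            (hcWeight α β (k + 1 - j) : ℂ) * hcGamma α β 0 j z) / ((k : ℂ) + 1) :=
          funext fun _ => recipSum_hcPoly_succ_zero k
        rw [this]
        refine DifferentiableAt.div_const (DifferentiableAt.fun_sum fun j hj => ?_) _
        exact (ih j (Finset.mem_range.1 hj) 0 z hz).const_mul _
      | succ m =>
        have : hcGamma α β (m + 1) (k + 1) = fun z => (∑ j ∈ Finset.range (k + 1),
            (hcWeight α β (k + 1 - j) : ℂ) * (hcGamma α β (m + 1) j z +
              (hcShift α β k j : ℂ) / ((k : ℂ) + 1 - Complex.I * z) * hcGamma α β m j z)) /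
              ((k : ℂ) + 1) :=
          funext fun _ => isGradedSolution_hcGamma.succ m k
        rw [this]
        refine DifferentiableAt.div_const (DifferentiableAt.fun_sum fun j hj => ?_) _
        have hj' := Finset.mem_range.1 hj
        refine ((ih j hj' (m + 1) z hz).add (DifferentiableAt.mul ?_ (ih j hj' m z hz))).const_mul _
        exact (differentiableAt_const _).div
          ((differentiableAt_const _).sub (differentiableAt_id.const_mul _)) (hz k)

lemma norm_hcGamma_le_of_im (hβα : β < α) (hβ : -(1 / 2) < β) (hρ : 0 < jacobiRho α β)
    (h : -(1 / 2) < lam.im) (m k : ℕ) :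
    ‖hcGamma α β m k lam‖ ≤ growthBound 0 (hcGrowth α β) k :=
  isGradedSolution_hcGamma.norm_le_of_im hβα hβ hρ h (norm_recipSum_hcPoly_zero_le hβα hβ hρ) m k

lemma norm_hcGamma_le_of_re (hβα : β < α) (hβ : -(1 / 2) < β) (hρ : 0 < jacobiRho α β)
    (h : lam.re ≠ 0) (m k : ℕ) : ‖hcGamma α β m k lam‖ ≤
      growthBound 1 (hcGrowth α β) k * (jacobiRho α β / |lam.re|) ^ m :=
  isGradedSolution_hcGamma.norm_le_of_re hβα hβ hρ h (norm_recipSum_hcPoly_zero_le hβα hβ hρ) m k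

lemma norm_hcError_le_of_im (hβα : β < α) (hβ : -(1 / 2) < β) (hρ : 0 < jacobiRho α β)
    (h : -(1 / 2) < lam.im) (m k : ℕ) :
    ‖hcError α β m k lam‖ ≤ growthBound 0 (hcGrowth α β) k :=
  (isGradedSolution_hcError (sub_ne_zero_of_im h)).norm_le_of_im hβα hβ hρ h
    (norm_hcError_zero_le hβα hβ hρ h) m k

lemma norm_hcError_le_of_re (hβα : β < α) (hβ : -(1 / 2) < β) (hρ : 0 < jacobiRho α β)
    (hi : -(1 / 2) < lam.im) (h : lam.re ≠ 0) (m k : ℕ) : ‖hcError α β m k lam‖ ≤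
      growthBound 1 (hcGrowth α β) k * (jacobiRho α β / |lam.re|) ^ m :=
  (isGradedSolution_hcError (sub_ne_zero_of_im hi)).norm_le_of_re hβα hβ hρ h
    (norm_hcError_zero_le hβα hβ hρ hi) m k

end

/-! ### Holomorphy and Cauchy estimates -/

/-- Cauchy's estimate on the disc of radius `|Re λ| / (m + 2)` about `λ`: on it `|Re z|^{-m}`
exceeds `|Re λ|^{-m}` by a factor of at most `(1 + 1/(m+1))^m ≤ e`. -/
lemma norm_iteratedDeriv_le_of_re {f : ℂ → ℂ} {C : ℝ} {m : ℕ} (hC : 0 ≤ C)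
    (hf : ∀ z : ℂ, z.re ≠ 0 → DifferentiableAt ℂ f z)
    (hb : ∀ z : ℂ, z.re ≠ 0 → ‖f z‖ ≤ C / |z.re| ^ m) (a : ℕ) {lam : ℂ} (h : lam.re ≠ 0) :
    ‖iteratedDeriv a f lam‖ ≤
      a.factorial * ((m : ℝ) + 2) ^ a * Real.exp 1 * C / |lam.re| ^ (m + a) := by
  have hr := abs_pos.2 h
  have hR : 0 < |lam.re| / ((m : ℝ) + 2) := by positivity
  have hre : ∀ z ∈ Metric.closedBall lam (|lam.re| / ((m : ℝ) + 2)),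
      |lam.re| * (((m : ℝ) + 1) / (m + 2)) ≤ |z.re| := by
    intro z hz
    rw [mem_closedBall_iff_norm] at hz
    have h1 := (Complex.abs_re_le_norm (z - lam)).trans hz
    rw [Complex.sub_re] at h1
    have h2 := abs_sub_abs_le_abs_sub lam.re z.re
    rw [abs_sub_comm lam.re] at h2
    have h3 : |lam.re| * (((m : ℝ) + 1) / (m + 2)) = |lam.re| - |lam.re| / ((m : ℝ) + 2) := by
      field_simp; ring
    linarith
  have hre0 : ∀ z ∈ Metric.closedBall lam (|lam.re| / ((m : ℝ) + 2)), z.re ≠ 0 := fun z hz =>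
    abs_pos.1 (lt_of_lt_of_le (by positivity) (hre z hz))
  have hd : DiffContOnCl ℂ f (Metric.ball lam (|lam.re| / ((m : ℝ) + 2))) := by
    refine DifferentiableOn.diffContOnCl fun z hz => ?_
    rw [closure_ball _ hR.ne'] at hz
    exact (hf z (hre0 z hz)).differentiableWithinAt
  have hs : ∀ z ∈ Metric.sphere lam (|lam.re| / ((m : ℝ) + 2)),
      ‖f z‖ ≤ Real.exp 1 * C / |lam.re| ^ m := by
    intro z hz
    have hz' := Metric.sphere_subset_closedBall hz
    have he : (((m : ℝ) + 2) / (m + 1)) ^ m ≤ Real.exp 1 := by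
      have h1 := Real.add_one_le_exp (1 / ((m : ℝ) + 1))
      calc (((m : ℝ) + 2) / (m + 1)) ^ m = (1 / ((m : ℝ) + 1) + 1) ^ m := by
            congr 1; field_simp; ring
        _ ≤ Real.exp (1 / ((m : ℝ) + 1)) ^ m := by gcongr
        _ = Real.exp (m * (1 / ((m : ℝ) + 1))) := by rw [← Real.exp_nat_mul]
        _ ≤ Real.exp 1 := by
            rw [Real.exp_le_exp, mul_one_div, div_le_one (by positivity)]; linarith
    calc ‖f z‖ ≤ C / |z.re| ^ m := hb z (hre0 z hz')
      _ ≤ C / (|lam.re| * (((m : ℝ) + 1) / (m + 2))) ^ m := by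
          gcongr; exact hre z hz'
      _ = (((m : ℝ) + 2) / (m + 1)) ^ m * C / |lam.re| ^ m := by
          rw [mul_pow, div_pow, div_pow]; field_simp
      _ ≤ _ := by gcongr
  refine (Complex.norm_iteratedDeriv_le_of_forall_mem_sphere_norm_le a hR hd hs).trans_eq ?_
  rw [div_pow, pow_add]; field_simp

/-- Derivatives along a horizontal line are complex derivatives. -/
lemma iteratedDeriv_horizontal (y : ℝ) {U : Set ℂ} (hU : IsOpen U)
    (hy : ∀ x : ℝ, (x : ℂ) + (y : ℂ) * Complex.I ∈ U) (a : ℕ) :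
    ∀ {f : ℂ → ℂ}, DifferentiableOn ℂ f U → ∀ x : ℝ,
      iteratedDeriv a (fun x : ℝ => f ((x : ℂ) + (y : ℂ) * Complex.I)) x =
        iteratedDeriv a f ((x : ℂ) + (y : ℂ) * Complex.I) := by
  induction a with
  | zero => intro f _ x; simp
  | succ a ih =>
    intro f hf x
    have hd : deriv (fun x : ℝ => f ((x : ℂ) + (y : ℂ) * Complex.I)) =
        fun x : ℝ => deriv f ((x : ℂ) + (y : ℂ) * Complex.I) := by
      funext x
      have h1 := (hf.differentiableAt (hU.mem_nhds (hy x))).hasDerivAt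
      have h2 : HasDerivAt (fun x : ℂ => x + (y : ℂ) * Complex.I) 1 (x : ℂ) :=
        (hasDerivAt_id _).add_const _
      simpa using (h1.comp (x : ℂ) h2).comp_ofReal.deriv
    rw [iteratedDeriv_succ', iteratedDeriv_succ', hd]
    exact ih (hf.deriv hU) x

/-- Dirichlet series with locally bounded holomorphic coefficients are holomorphic in the
parameter, together with all their derivatives in `t`. -/
lemma differentiableOn_iteratedDeriv_dirichletSum {σ : ℝ} {c : ℕ → ℂ → ℂ} {B : ℕ → ℂ} {U : Set ℂ}
    (hU : IsOpen U) (hc : ∀ j, DifferentiableOn ℂ (c j) U) (hB : AbsConvAbove σ B)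
    (hcB : ∀ j, ∀ z ∈ U, ‖c j z‖ ≤ ‖B j‖) (b : ℕ) {t : ℝ} (ht : σ < t) :
    DifferentiableOn ℂ (fun z => iteratedDeriv b (dirichletSum fun j => c j z) t) U := by
  have h1 : DifferentiableOn ℂ
      (fun z => dirichletSum (fun j => c j z * (-(2 * (j : ℂ))) ^ b) t) U := by
    refine Complex.differentiableOn_tsum_of_summable_norm (hB.mul_pow b t ht)
      (fun j => ((hc j).mul_const _).mul_const _) hU fun j z hz => ?_
    rw [norm_dirichlet_term, norm_mul_neg_two_mul_pow, norm_mul_neg_two_mul_pow]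
    gcongr
    exact hcB j z hz
  refine h1.congr fun z hz => ?_
  have hz' : AbsConvAbove σ fun j => c j z := AbsConvAbove.of_le (fun j => hcB j z hz) hB
  exact hz'.iteratedDeriv_eq b ht

section

variable {α β : ℝ} {lam : ℂ}

lemma isOpen_im_gt (y : ℝ) : IsOpen {z : ℂ | y < z.im} :=
  isOpen_lt continuous_const Complex.continuous_im

lemma differentiableOn_hcGamma (m k : ℕ) :
    DifferentiableOn ℂ (hcGamma α β m k) {z : ℂ | -(1 / 2) < z.im} := fun z hz =>
  (differentiableAt_hcGamma k m z (sub_ne_zero_of_im hz)).differentiableWithinAt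

lemma hcLambda_eq (γ : ℕ → ℕ → ℂ → ℂ) (m : ℕ) (lam : ℂ) :
    hcLambda γ m lam = dirichletSum fun j => γ m (m + j) lam := rfl

lemma absConvAbove_hcGamma (hβα : β < α) (hβ : -(1 / 2) < β) (hρ : 0 < jacobiRho α β)
    (h : -(1 / 2) < lam.im) (m n : ℕ) : AbsConvAbove 0 fun j => hcGamma α β m (n + j) lam :=
  absConvAbove_of_le_growthBound hρ n fun j => norm_hcGamma_le_of_im hβα hβ hρ h m (n + j)

lemma absConvAbove_hcError (hβα : β < α) (hβ : -(1 / 2) < β) (hρ : 0 < jacobiRho α β)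
    (h : -(1 / 2) < lam.im) (m n : ℕ) : AbsConvAbove 0 fun j => hcError α β m (n + j) lam :=
  absConvAbove_of_le_growthBound hρ n fun j => norm_hcError_le_of_im hβα hβ hρ h m (n + j)

lemma differentiableOn_iteratedDeriv_hcLambda_im (hβα : β < α) (hβ : -(1 / 2) < β)
    (hρ : 0 < jacobiRho α β) (m b : ℕ) {t : ℝ} (ht : 1 < t) :
    DifferentiableOn ℂ (fun z => iteratedDeriv b (hcLambda (hcGamma α β) m z) t)
      {z : ℂ | -(1 / 2) < z.im} := by
  have hB0 := fun k => growthBound_nonneg le_rfl (hcGrowth_pos hρ).le (k := k)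
  have hn : ∀ j, ‖((growthBound 0 (hcGrowth α β) (m + j) : ℝ) : ℂ)‖ =
      growthBound 0 (hcGrowth α β) (m + j) := fun j => by
    rw [Complex.norm_real, Real.norm_of_nonneg (hB0 _)]
  refine differentiableOn_iteratedDeriv_dirichletSum (isOpen_im_gt _)
    (fun j => differentiableOn_hcGamma m (m + j))
    (absConvAbove_of_le_growthBound hρ m fun j => (hn j).le) (fun j z hz => ?_) b
    (zero_lt_one.trans ht)
  rw [hn]
  exact norm_hcGamma_le_of_im hβα hβ hρ hz m (m + j)

/-- Off the imaginary axis `Λ_m` is holomorphic also outside the half-plane; the discs of the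
Cauchy estimate reach there. -/
lemma differentiableAt_iteratedDeriv_hcLambda_re (hβα : β < α) (hβ : -(1 / 2) < β)
    (hρ : 0 < jacobiRho α β) (m b : ℕ) {t : ℝ} (ht : 1 < t) (h : lam.re ≠ 0) :
    DifferentiableAt ℂ (fun z => iteratedDeriv b (hcLambda (hcGamma α β) m z) t) lam := by
  obtain ⟨A, hA0, hA⟩ := exists_growthBound_one_le_exp (hcGrowth_pos hρ).le 0
  have hr := abs_pos.2 h
  set C : ℝ := A * Real.exp (2 * m) * (jacobiRho α β / (|lam.re| / 2)) ^ m with hCdef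
  have hU : IsOpen {z : ℂ | |lam.re| / 2 < |z.re|} :=
    isOpen_lt continuous_const Complex.continuous_re.abs
  have hn : ∀ j : ℕ, ‖((C * Real.exp (2 * j) : ℝ) : ℂ)‖ = C * Real.exp (2 * j) := fun j => by
    rw [Complex.norm_real, Real.norm_of_nonneg (by positivity)]
  have hd := differentiableOn_iteratedDeriv_dirichletSum hU
    (c := fun j => hcGamma α β m (m + j)) (B := fun j => ((C * Real.exp (2 * j) : ℝ) : ℂ))
    (fun j z hz => (differentiableAt_hcGamma (m + j) m z (sub_ne_zero_of_re
      (abs_pos.1 (lt_trans (by positivity) hz)))).differentiableWithinAt)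
    (absConvAbove_one_of_le fun j => (hn j).le) (fun j z hz => ?_) b ht
  · exact hd.differentiableAt (hU.mem_nhds (show |lam.re| / 2 < |lam.re| by linarith))
  · have hz' : |lam.re| / 2 < |z.re| := hz
    have hz0 : 0 < |z.re| := lt_trans (by positivity) hz'
    rw [hn]
    have h2 := growthBound_le_of_zeroth (hcGrowth_pos hρ).le hA (m + j)
    push_cast at h2
    calc ‖hcGamma α β m (m + j) z‖
        ≤ growthBound 1 (hcGrowth α β) (m + j) * (jacobiRho α β / |z.re|) ^ m :=
          norm_hcGamma_le_of_re hβα hβ hρ (abs_pos.1 hz0) m (m + j)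
      _ ≤ A * Real.exp (2 * (m + j)) * (jacobiRho α β / (|lam.re| / 2)) ^ m := by gcongr
      _ = C * Real.exp (2 * j) := by rw [hCdef, mul_add, Real.exp_add]; ring

/-! ### Summation of the expansion -/

lemma dirichletSum_eq_exp_mul {c : ℕ → ℂ} {m : ℕ} (h0 : ∀ k < m, c k = 0)
    (hc : AbsConvAbove 0 c) {t : ℝ} (ht : 0 < t) :
    dirichletSum c t =
      dirichletSum (fun j => c (m + j)) t * (Real.exp (-(2 * (m : ℝ) * t)) : ℂ) := by
  have h1 := (hc.summable ht).sum_add_tsum_nat_add m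
  rw [Finset.sum_eq_zero fun k hk => by rw [h0 k (Finset.mem_range.1 hk), zero_mul],
    zero_add] at h1
  rw [dirichletSum, ← h1, dirichletSum, ← tsum_mul_right]
  refine tsum_congr fun j => ?_
  have e : Real.exp (-(2 * ((j + m : ℕ) : ℝ) * t)) =
      Real.exp (-(2 * (j : ℝ) * t)) * Real.exp (-(2 * (m : ℝ) * t)) := by
    rw [← Real.exp_add]; congr 1; push_cast; ring
  rw [e, add_comm j m]; push_cast; ring

lemma hcLambda_mul_exp (hβα : β < α) (hβ : -(1 / 2) < β) (hρ : 0 < jacobiRho α β)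
    (h : -(1 / 2) < lam.im) (m : ℕ) {t : ℝ} (ht : 0 < t) :
    hcLambda (hcGamma α β) m lam t * (Real.exp (-(2 * (m : ℝ) * t)) : ℂ) =
      dirichletSum (fun k => hcGamma α β m k lam) t :=
  (dirichletSum_eq_exp_mul (fun k hk => isGradedSolution_hcGamma.eq_zero_of_lt k m hk)
    (by simpa using absConvAbove_hcGamma hβα hβ hρ h m 0) ht).symm

lemma hcCoeff_eq_sum_add_hcError (M k : ℕ) : hcCoeff α β lam k =
    ∑ m ∈ Finset.range M, hcGamma α β m k lam + hcError α β M k lam := by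
  simp [hcError, hcGamma]

lemma hcSeries_eq_sum_add (hβα : β < α) (hβ : -(1 / 2) < β) (hρ : 0 < jacobiRho α β)
    (h : -(1 / 2) < lam.im) (M : ℕ) {t : ℝ} (ht : 0 < t) :
    hcSeries α β lam t =
      ∑ m ∈ Finset.range M,
        hcLambda (hcGamma α β) m lam t * (Real.exp (-(2 * (m : ℝ) * t)) : ℂ) +
      (Real.exp (-(2 * (M : ℝ) * t)) : ℂ) *
        dirichletSum (fun j => hcError α β M (M + j) lam) t := by
  have hE : AbsConvAbove 0 fun k => hcError α β M k lam := by
    simpa using absConvAbove_hcError hβα hβ hρ h M 0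
  have hγ : ∀ m, AbsConvAbove 0 fun k => hcGamma α β m k lam := fun m => by
    simpa using absConvAbove_hcGamma hβα hβ hρ h m 0
  rw [mul_comm, ← dirichletSum_eq_exp_mul (fun k hk =>
    (isGradedSolution_hcError (sub_ne_zero_of_im h)).eq_zero_of_lt k M hk) hE ht]
  simp only [hcLambda_mul_exp hβα hβ hρ h _ ht]
  refine ((absConvAbove_hcCoeff hβα hβ hρ h).hasSum ht).unique ?_
  refine ((hasSum_sum fun m (_ : m ∈ Finset.range M) => (hγ m).hasSum ht).add
    (hE.hasSum ht)).congr_fun fun k => ?_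
  rw [hcCoeff_eq_sum_add_hcError M k, add_mul, Finset.sum_mul]

/-- The double series `∑_{m,k} γ_m^k e^{-2kt}` converges absolutely: as `γ_m^k = 0` for `k < m`,
half of the decay in `k` may be spent on decay in `m`. -/
lemma hasSum_hcLambda (hβα : β < α) (hβ : -(1 / 2) < β) (hρ : 0 < jacobiRho α β)
    (h : -(1 / 2) < lam.im) {t : ℝ} (ht : 0 < t) :
    HasSum (fun m : ℕ => hcLambda (hcGamma α β) m lam t * (Real.exp (-(2 * (m : ℝ) * t)) : ℂ))
      (hcSeries α β lam t) := by
  set F : ℕ × ℕ → ℂ := fun p =>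
    hcGamma α β p.1 p.2 lam * (Real.exp (-(2 * (p.2 : ℝ) * t)) : ℂ) with hF
  have hzero : ∀ k m : ℕ, k < m → hcGamma α β m k lam = 0 :=
    isGradedSolution_hcGamma.eq_zero_of_lt
  have hB0 := fun k => growthBound_nonneg le_rfl (hcGrowth_pos hρ).le (k := k)
  have hsum : Summable F := by
    have h1 : Summable fun m : ℕ => Real.exp (m * -t) :=
      Real.summable_exp_nat_mul_iff.2 (neg_lt_zero.2 ht)
    have h2 := summable_growthBound_mul_exp (hcGrowth_pos hρ).le (half_pos ht)
    refine Summable.of_norm_bounded (h1.mul_of_nonneg h2 (fun m => (Real.exp_pos _).le)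
      fun k => mul_nonneg (hB0 k) (Real.exp_pos _).le) fun ⟨m, k⟩ => ?_
    rw [hF, norm_dirichlet_term]
    rcases lt_or_ge k m with hk | hk
    · have := hB0 k
      simp only [hzero k m hk, norm_zero, zero_mul]
      positivity
    · have hk' : (m : ℝ) ≤ k := by exact_mod_cast hk
      calc ‖hcGamma α β m k lam‖ * Real.exp (-(2 * (k : ℝ) * t))
          ≤ growthBound 0 (hcGrowth α β) k *
              (Real.exp (m * -t) * Real.exp (-(2 * (k : ℝ) * (t / 2)))) := by
            rw [← Real.exp_add]
            refine mul_le_mul (norm_hcGamma_le_of_im hβα hβ hρ h m k)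
              (Real.exp_le_exp.2 ?_) (Real.exp_pos _).le (hB0 k)
            nlinarith
        _ = _ := by ring
  have hrow : HasSum (fun k : ℕ => hcCoeff α β lam k * (Real.exp (-(2 * (k : ℝ) * t)) : ℂ))
      (∑' p, F p) := by
    refine HasSum.prod_fiberwise (f := fun p : ℕ × ℕ => F p.swap)
      ((Equiv.prodComm ℕ ℕ).hasSum_iff.2 hsum.hasSum) fun k => ?_
    rw [hcCoeff_eq_sum_add_hcError (k + 1) k,
      (isGradedSolution_hcError (sub_ne_zero_of_im h)).eq_zero_of_lt k (k + 1) k.lt_succ_self,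
      add_zero, Finset.sum_mul]
    refine hasSum_sum_of_ne_finset_zero fun m hm => ?_
    simp only [Finset.mem_range, not_lt] at hm
    simp [hF, hzero k m (by omega)]
  rw [show hcSeries α β lam t = ∑' p, F p from hrow.tsum_eq]
  refine HasSum.prod_fiberwise hsum.hasSum fun m => ?_
  rw [hcLambda_mul_exp hβα hβ hρ h m ht]
  have hγ : AbsConvAbove 0 fun k => hcGamma α β m k lam := by
    simpa using absConvAbove_hcGamma hβα hβ hρ h m 0
  exact hγ.hasSum ht

end

/-! ### Bounds on the derivatives -/

section

variable {α β : ℝ} {lam : ℂ}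

/-- As `γ_m^k = 0` for `m > k`, the factor `(m + 2)^a` of Cauchy's estimate is at most
`(k + 2)^a`. -/
lemma norm_iteratedDeriv_hcGamma_le (hβα : β < α) (hβ : -(1 / 2) < β) (hρ : 0 < jacobiRho α β)
    {a : ℕ} {A : ℝ} (hA : ∀ k : ℕ, a.factorial * ((k : ℝ) + 2) ^ a * Real.exp 1 *
      growthBound 1 (hcGrowth α β) k ≤ A * Real.exp (2 * k)) (m k : ℕ) (h : lam.re ≠ 0) :
    ‖iteratedDeriv a (hcGamma α β m k) lam‖ ≤
      A * (jacobiRho α β ^ m * Real.exp (2 * k) / |lam.re| ^ (m + a)) := by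
  have hB := growthBound_nonneg zero_le_one (hcGrowth_pos hρ).le k
  have hr := abs_pos.2 h
  have hd : ∀ z : ℂ, z.re ≠ 0 → DifferentiableAt ℂ (hcGamma α β m k) z := fun z hz =>
    differentiableAt_hcGamma k m z (sub_ne_zero_of_re hz)
  rcases lt_or_ge k m with hk | hk
  · have h0 := norm_iteratedDeriv_le_of_re (C := 0) (m := m) le_rfl hd (fun z _ => by
      have : hcGamma α β m k z = 0 := isGradedSolution_hcGamma.eq_zero_of_lt k m hk
      simp [this]) a h
    have hA' : 0 ≤ A * Real.exp (2 * k) := le_trans (by positivity) (hA k)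
    refine h0.trans ?_
    calc _ = (0 : ℝ) := by simp
      _ ≤ (A * Real.exp (2 * k)) * (jacobiRho α β ^ m / |lam.re| ^ (m + a)) := by positivity
      _ = _ := by ring
  · refine (norm_iteratedDeriv_le_of_re (m := m)
      (C := growthBound 1 (hcGrowth α β) k * jacobiRho α β ^ m) (by positivity) hd
      (fun z hz => ?_) a h).trans ?_
    · rw [mul_div_assoc, ← div_pow]
      exact norm_hcGamma_le_of_re hβα hβ hρ hz m k
    · have hk' : (m : ℝ) ≤ k := by exact_mod_cast hk
      calc a.factorial * ((m : ℝ) + 2) ^ a * Real.exp 1 *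
              (growthBound 1 (hcGrowth α β) k * jacobiRho α β ^ m) / |lam.re| ^ (m + a)
          = (a.factorial * ((m : ℝ) + 2) ^ a * Real.exp 1 * growthBound 1 (hcGrowth α β) k) *
              (jacobiRho α β ^ m / |lam.re| ^ (m + a)) := by ring
        _ ≤ (a.factorial * ((k : ℝ) + 2) ^ a * Real.exp 1 * growthBound 1 (hcGrowth α β) k) *
              (jacobiRho α β ^ m / |lam.re| ^ (m + a)) := by gcongr
        _ ≤ (A * Real.exp (2 * k)) * (jacobiRho α β ^ m / |lam.re| ^ (m + a)) := by
            exact mul_le_mul_of_nonneg_right (hA k) (by positivity)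
        _ = _ := by ring

lemma hcG_nonneg (b : ℕ) (t : ℝ) : 0 ≤ hcG b t := tsum_nonneg fun j => by positivity

lemma norm_iteratedDeriv_hcLambda_le (hβα : β < α) (hβ : -(1 / 2) < β) (hρ : 0 < jacobiRho α β)
    {a : ℕ} {A : ℝ} (hA0 : 0 ≤ A) (hA : ∀ k : ℕ, a.factorial * ((k : ℝ) + 2) ^ a * Real.exp 1 *
      growthBound 1 (hcGrowth α β) k ≤ A * Real.exp (2 * k)) (m b : ℕ) {t : ℝ} (ht : 1 < t)
    (h : lam.re ≠ 0) :
    ‖iteratedDeriv a (fun z : ℂ => iteratedDeriv b (hcLambda (hcGamma α β) m z) t) lam‖ ≤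
      2 ^ b * A * (jacobiRho α β ^ m * Real.exp (2 * m) / |lam.re| ^ (m + a)) * hcG b t := by
  have hG := hcG_nonneg b t
  have hr := abs_pos.2 h
  -- Dividing by this factor beforehand compensates for the loss in Cauchy's estimate.
  set D : ℝ := a.factorial * ((m : ℝ) + 2) ^ a * Real.exp 1 with hD
  have hD0 : 0 < D := by positivity
  refine (norm_iteratedDeriv_le_of_re (m := m)
    (C := 2 ^ b * (A / D * Real.exp (2 * m) * jacobiRho α β ^ m) * hcG b t) (by positivity)
    (fun z hz => differentiableAt_iteratedDeriv_hcLambda_re hβα hβ hρ m b ht hz)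
    (fun z hz => ?_) a h).trans_eq ?_
  · have hz0 := abs_pos.2 hz
    have hc : ∀ j : ℕ, ‖hcGamma α β m (m + j) z‖ ≤
        (A / D * Real.exp (2 * m) * jacobiRho α β ^ m / |z.re| ^ m) * Real.exp (2 * j) := by
      intro j
      have hB := growthBound_nonneg zero_le_one (hcGrowth_pos hρ).le (m + j)
      have h1 : growthBound 1 (hcGrowth α β) (m + j) ≤ A / D * Real.exp (2 * (m + j)) := by
        rw [div_mul_eq_mul_div, le_div_iff₀ hD0, mul_comm]
        have h2 := hA (m + j)
        push_cast at h2
        refine le_trans ?_ h2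
        rw [hD]
        gcongr
        linarith [(j.cast_nonneg : (0 : ℝ) ≤ j)]
      calc ‖hcGamma α β m (m + j) z‖
          ≤ growthBound 1 (hcGrowth α β) (m + j) * (jacobiRho α β / |z.re|) ^ m :=
            norm_hcGamma_le_of_re hβα hβ hρ hz m (m + j)
        _ ≤ A / D * Real.exp (2 * (m + j)) * (jacobiRho α β / |z.re|) ^ m := by gcongr
        _ = _ := by rw [mul_add, Real.exp_add, div_pow]; ring
    rw [hcLambda_eq]
    refine (norm_iteratedDeriv_dirichletSum_le hc b ht).trans_eq ?_
    ring
  · rw [← hD]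
    field_simp

end

/-! ### The asymptotic expansion -/

theorem mainTheorem4 (α β : ℝ) (hα : 1 / 2 < α) (hβα : β < α) (hβ : -(1 / 2) < β) :
    ∃ (P : ℕ → ℕ → Multiset (Polynomial ℂ)) (γ E : ℕ → ℕ → ℂ → ℂ)
      (Err : ℕ → ℂ → ℝ → ℂ) (A : ℕ → ℝ),
      -- (i) `γ m k` is a finite sum of reciprocals of polynomials of degree `m`
      (∀ m k : ℕ, ∀ f ∈ P m k, f.degree = (m : WithBot ℕ) ∧
        ∀ lam : ℂ, 0 ≤ lam.im → f.eval lam ≠ 0) ∧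
      (∀ (m k : ℕ) (lam : ℂ), γ m k lam = recipSum (P m k) lam) ∧
      -- the expansion of the Harish-Chandra coefficients
      (∀ (M k : ℕ) (lam : ℂ), 0 ≤ lam.im →
        hcCoeff α β lam k = ∑ m ∈ Finset.range (M + 1), γ m k lam + E (M + 1) k lam) ∧
      -- the bounds on `γ m k`, on its derivatives in `Re λ`, and on the error term
      (∀ (m k : ℕ) (lam : ℂ), 0 ≤ lam.im → lam.re ≠ 0 →
        ‖γ m k lam‖ ≤ A 0 * (|jacobiRho α β| ^ m * Real.exp (2 * k) / |lam.re| ^ m)) ∧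
      (∀ (a m k : ℕ) (lam : ℂ), 0 ≤ lam.im → lam.re ≠ 0 →
        ‖iteratedDeriv a (fun x : ℝ => γ m k ((x : ℂ) + (lam.im : ℂ) * Complex.I)) lam.re‖ ≤
          2 ^ a * A a * (|jacobiRho α β| ^ m * Real.exp (2 * k) / |lam.re| ^ (m + a))) ∧
      (∀ (M k : ℕ) (lam : ℂ), 0 ≤ lam.im → lam.re ≠ 0 →
        ‖E (M + 1) k lam‖ ≤
          A 0 * (|jacobiRho α β| ^ (M + 1) * Real.exp (2 * k) / |lam.re| ^ (M + 1))) ∧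
      -- (ii) the Harish-Chandra series converges to the solution `φ_λ`
      (∀ lam : ℂ, 0 ≤ lam.im →
        (∀ t : ℝ, 0 < t →
          Summable fun k : ℕ => hcCoeff α β lam k * (Real.exp (-(2 * (k : ℝ) * t)) : ℂ)) ∧
        IsJacobiSolutionAtInfinity α β lam fun t : ℝ =>
          Complex.exp ((Complex.I * lam - (jacobiRho α β : ℂ)) * (t : ℂ)) * hcSeries α β lam t) ∧
      -- the series `Λ_m` converge, and the derivatives estimated below exist
      (∀ (m : ℕ) (lam : ℂ) (t : ℝ), 0 ≤ lam.im → 1 < t →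
        Summable fun j : ℕ => γ m (m + j) lam * (Real.exp (-(2 * (j : ℝ) * t)) : ℂ)) ∧
      (∀ (m : ℕ) (lam : ℂ), 0 ≤ lam.im →
        ContDiffOn ℝ ∞ (fun t : ℝ => hcLambda γ m lam t) (Set.Ioi 1)) ∧
      (∀ (m b : ℕ) (t : ℝ), 1 < t →
        AnalyticOnNhd ℂ (fun z : ℂ => iteratedDeriv b (fun s : ℝ => hcLambda γ m z s) t)
          {z : ℂ | 0 ≤ z.im}) ∧
      (∀ (M : ℕ) (lam : ℂ), 0 ≤ lam.im →
        ContDiffOn ℝ ∞ (fun t : ℝ => Err (M + 1) lam t) (Set.Ioi 1)) ∧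
      -- the infinite expansion and the finite expansion with remainder
      (∀ (lam : ℂ) (t : ℝ), 0 ≤ lam.im → 1 < t →
        HasSum (fun m : ℕ => hcLambda γ m lam t * (Real.exp (-(2 * (m : ℝ) * t)) : ℂ))
          (hcSeries α β lam t)) ∧
      (∀ (M : ℕ) (lam : ℂ) (t : ℝ), 0 ≤ lam.im → 1 < t →
        hcSeries α β lam t =
          ∑ m ∈ Finset.range (M + 1), hcLambda γ m lam t * (Real.exp (-(2 * (m : ℝ) * t)) : ℂ)
            + (Real.exp (-(2 * ((M : ℝ) + 1) * t)) : ℂ) * Err (M + 1) lam t) ∧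
      -- the bounds on the derivatives
      (∀ (a b m : ℕ) (lam : ℂ) (t : ℝ), 0 ≤ lam.im → lam.re ≠ 0 → 1 < t →
        ‖iteratedDeriv a
            (fun z : ℂ => iteratedDeriv b (fun s : ℝ => hcLambda γ m z s) t) lam‖ ≤
          2 ^ (a + b) * A a *
            (|jacobiRho α β| ^ m * Real.exp (2 * m) / |lam.re| ^ (m + a)) * hcG b t) ∧
      (∀ (b M : ℕ) (lam : ℂ) (t : ℝ), 0 ≤ lam.im → lam.re ≠ 0 → 1 < t →
        ‖iteratedDeriv b (fun s : ℝ => Err (M + 1) lam s) t‖ ≤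
          2 ^ b * A 0 *
            (Real.exp (2 * (M + 1)) * |jacobiRho α β| ^ (M + 1) / |lam.re| ^ (M + 1)) *
            hcG b t) := by
  have hρ : 0 < jacobiRho α β := by unfold jacobiRho; linarith
  have hK := (hcGrowth_pos hρ).le
  choose A hA0 hA using exists_growthBound_one_le_exp hK
  have hA1 := growthBound_le_of_zeroth hK (hA 0)
  have him : ∀ {lam : ℂ}, 0 ≤ lam.im → -(1 / 2) < lam.im := fun h => by linarith
  have hpow : ∀ a : ℕ, (1 : ℝ) ≤ 2 ^ a := fun a => one_le_pow₀ one_le_two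
  refine ⟨fun m k => hcPoly α β k m, hcGamma α β, hcError α β,
    fun M lam => dirichletSum fun j => hcError α β M (M + j) lam, A,
    fun m k => degree_hcPoly_and_eval_ne_zero hβα hρ k m, fun m k lam => rfl,
    fun M k lam _ => hcCoeff_eq_sum_add_hcError (M + 1) k, ?_, ?_, ?_, ?_, ?_, ?_, ?_, ?_, ?_, ?_,
    ?_, ?_⟩
  · intro m k lam _ hre
    have hr := abs_pos.2 hre
    rw [abs_of_pos hρ]
    calc ‖hcGamma α β m k lam‖
        ≤ growthBound 1 (hcGrowth α β) k * (jacobiRho α β / |lam.re|) ^ m :=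
          norm_hcGamma_le_of_re hβα hβ hρ hre m k
      _ ≤ A 0 * Real.exp (2 * k) * (jacobiRho α β / |lam.re|) ^ m := by gcongr; exact hA1 k
      _ = _ := by rw [div_pow]; ring
  · intro a m k lam hi hre
    have hr := abs_pos.2 hre
    rw [iteratedDeriv_horizontal lam.im (isOpen_im_gt (-(1 / 2)))
      (fun x => by simpa using him hi) a (differentiableOn_hcGamma m k) lam.re,
      Complex.re_add_im, abs_of_pos hρ]
    refine (norm_iteratedDeriv_hcGamma_le hβα hβ hρ (hA a) m k hre).trans ?_
    have := hA0 a
    gcongr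
    exact le_mul_of_one_le_left this (hpow a)
  · intro M k lam hi hre
    have hr := abs_pos.2 hre
    rw [abs_of_pos hρ]
    calc ‖hcError α β (M + 1) k lam‖
        ≤ growthBound 1 (hcGrowth α β) k * (jacobiRho α β / |lam.re|) ^ (M + 1) :=
          norm_hcError_le_of_re hβα hβ hρ (him hi) hre (M + 1) k
      _ ≤ A 0 * Real.exp (2 * k) * (jacobiRho α β / |lam.re|) ^ (M + 1) := by
          gcongr; exact hA1 k
      _ = _ := by rw [div_pow]; ring
  · intro lam hi
    have hΓ := absConvAbove_hcCoeff hβα hβ hρ (him hi)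
    exact ⟨fun t ht => hΓ.summable ht,
      isJacobiSolutionAtInfinity_hcSeries hΓ (sub_ne_zero_of_im (him hi))⟩
  · intro m lam t hi ht
    exact (absConvAbove_hcGamma hβα hβ hρ (him hi) m m).summable (zero_lt_one.trans ht)
  · intro m lam hi
    exact (absConvAbove_hcGamma hβα hβ hρ (him hi) m m).contDiffOn.mono
      (Set.Ioi_subset_Ioi zero_le_one)
  · intro m b t ht
    exact ((differentiableOn_iteratedDeriv_hcLambda_im hβα hβ hρ m b ht).analyticOnNhd
      (isOpen_im_gt _)).mono fun z hz => him hz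
  · intro M lam hi
    exact (absConvAbove_hcError hβα hβ hρ (him hi) (M + 1) (M + 1)).contDiffOn.mono
      (Set.Ioi_subset_Ioi zero_le_one)
  · intro lam t hi ht
    exact hasSum_hcLambda hβα hβ hρ (him hi) (zero_lt_one.trans ht)
  · intro M lam t hi ht
    have h1 := hcSeries_eq_sum_add hβα hβ hρ (him hi) (M + 1) (zero_lt_one.trans ht)
    rwa [Nat.cast_add_one] at h1
  · intro a b m lam t _ hre ht
    rw [abs_of_pos hρ]
    refine (norm_iteratedDeriv_hcLambda_le hβα hβ hρ (hA0 a) (hA a) m b ht hre).trans ?_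
    have := hA0 a
    have hG := hcG_nonneg b t
    gcongr
    · exact one_le_two
    · exact Nat.le_add_left b a
  · intro b M lam t hi hre ht
    have hr := abs_pos.2 hre
    rw [abs_of_pos hρ]
    refine (norm_iteratedDeriv_dirichletSum_le (C := A 0 * (Real.exp (2 * (M + 1)) *
      jacobiRho α β ^ (M + 1) / |lam.re| ^ (M + 1))) (fun j => ?_) b ht).trans_eq
      (by ring)
    have h2 := hA1 (M + 1 + j)
    push_cast at h2
    calc ‖hcError α β (M + 1) (M + 1 + j) lam‖
        ≤ growthBound 1 (hcGrowth α β) (M + 1 + j) * (jacobiRho α β / |lam.re|) ^ (M + 1) :=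
          norm_hcError_le_of_re hβα hβ hρ (him hi) hre (M + 1) (M + 1 + j)
      _ ≤ A 0 * Real.exp (2 * (M + 1 + j)) * (jacobiRho α β / |lam.re|) ^ (M + 1) := by gcongr
      _ = _ := by rw [mul_add 2 ((M : ℝ) + 1), Real.exp_add, div_pow]; ring
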